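/- Corollary 5.3 (self-adjoint parts of direct sums of matrix algebras). Let $(m_j)_{j\in\Lambda}$ and $(n_k)_{k\in\Gamma}$ be families of positive integers, and let $\mathcal M=\bigoplus_{j\in\Lambda}B(\mathbb C^{m_j})$ and $\mathcal N=\bigoplus_{k\in\Gamma}B(\mathbb C^{n_k})$ be the C*-algebras of all families $(x_j)_j$ of operators with $\sup_j\|x_j\|<\infty$, with pointwise *-algebra operations and the supremum norm. Write $P(\mathcal A)$ for the lattice of projections of such an algebra $\mathcal A$. The spectral family of a self-adjoint $x\in\mathcal A_{sa}$ is the unique increasing, right-continuous family $(E^x_\lambda)_{\lambda\in\mathbb R}$ in $P(\mathcal A)$ (right-continuous meaning $E^x_\lambda=\bigwedge_{\mu>\lambda}E^x_\mu$) that is $0$ for all sufficiently small $\lambda$ and $\mathbf 1$ for all sufficiently large $\lambda$ and satisfies $xE^x_\lambda\le\lambda E^x_\lambda$ and $\lambda(\mathbf 1-E^x_\lambda)\le x(\mathbf 1-E^x_\lambda)$ for all $\lambda\in\mathbb R$. The spectral order on $\mathcal A_{sa}$ is defined by $x\preceq y$ if and only if $E^y_\lambda\le E^x_\lambda$ for all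 $\lambda\in\mathbb R$. Let $\Phi:\mathcal M_{sa}\to\mathcal N_{sa}$ be a spectral order isomorphism, that is, a bijection such that $x\preceq y$ if and only if $\Phi(x)\preceq\Phi(y)$ for all $x,y\in\mathcal M_{sa}$. Then there are a bijection $\pi:\Gamma\to\Lambda$ with $m_j=n_{\pi^{-1}(j)}$ for all $j\in\Lambda$, a family $(f_j)_{j\in\Lambda}$ of strictly increasing bijections $f_j:\mathbb R\to\mathbb R$, and a family $(\tau_j)_{j\in\Lambda}$ of order automorphisms $\tau_j$ of the projection lattice $P(B(\mathbb C^{m_j}))$ such that, for all $(x_j)_{j\in\Lambda}\in\mathcal M_{sa}$, $$\Phi\big((x_j)_{j\in\Lambda}\big)=\Big(\Theta_{\tau_{\pi(k)}}\big(f_{\pi(k)}(x_{\pi(k)})\big)\Big)_{k\in\Gamma}.$$ Here $f_j(x_j)$ is given by the continuous functional calculus, $\Theta_{\tau}$ is the map on self-adjoint operators defined by $E^{\Theta_{\tau}(x)}_\lambda=\tau(E^x_\lambda)$ for all $\lambda\in\mathbb R$, and $B(\mathbb C^{m_{\pi(k)}})$ is identified with $B(\mathbb C^{n_k})$ because $m_{\pi(k)}=n_k$.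 -/

import Mathlib

open scoped ENNReal

noncomputable section

section General

variable {A : Type*} [Ring A] [StarRing A]

/-- The standard order of a C*-algebra: `x ≤ y` when `y - x` is positive, that is, when
`y - x` is of the form `s* s`. -/
def StdLE (x y : A) : Prop := ∃ s : A, y - x = star s * s

variable (A) in
/-- The set `P(A)` of all (self-adjoint) projections of the *-algebra `A`. -/
@[ext] structure Proj where
  val : A
  isProj : IsStarProjection val

/-- The projection lattice. For projections of a C*-algebra, `p * q = p` says exactly that
`p ≤ q` for the standard order. -/
instance Proj.instPartialOrder : PartialOrder (Proj A) where
  le p q := p.val * q.val = p.val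
  le_refl p := p.isProj.isIdempotentElem
  le_trans p q r hpq hqr := by
    change p.val * q.val = p.val at hpq
    change q.val * r.val = q.val at hqr
    exact (by rw [← hpq, mul_assoc, hqr] : p.val * r.val = p.val)
  le_antisymm p q hpq hqp := by
    change p.val * q.val = p.val at hpq
    change q.val * p.val = q.val at hqp
    have h := congrArg star hpq
    rw [star_mul, p.isProj.isSelfAdjoint.star_eq, q.isProj.isSelfAdjoint.star_eq, hqp] at h
    exact Proj.ext h.symm

/-- A bounded spectral family of projections: increasing, right continuous, equal to `0` far to
the left and to `1` far to the right. The infimum is taken in the projection lattice. -/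
structure IsSpectralFamily (E : ℝ → Proj A) : Prop where
  mono : ∀ s t : ℝ, s ≤ t → E s ≤ E t
  isGLB : ∀ t : ℝ, IsGLB (E '' Set.Ioi t) (E t)
  bounded : ∃ α : ℝ, 0 < α ∧ (∀ t < -α, (E t).val = 0) ∧ (∀ t > α, (E t).val = 1)

variable [Algebra ℂ A]

/-- `E` is the spectral family of `x`: it is a spectral family with `x E_t ≤ t E_t` and
`t (1 - E_t) ≤ x (1 - E_t)` for every real `t`. -/
structure IsSpectralFamilyOf (x : A) (E : ℝ → Proj A) : Prop where
  isSpectralFamily : IsSpectralFamily E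
  mul_le : ∀ t : ℝ, StdLE (x * (E t).val) ((t : ℂ) • (E t).val)
  le_mul : ∀ t : ℝ, StdLE ((t : ℂ) • (1 - (E t).val)) (x * (1 - (E t).val))

/-- The spectral order `x ⪯ y` on the self-adjoint part: `E^y_t ≤ E^x_t` for every real `t`. -/
def SpectralLE (x y : selfAdjoint A) : Prop :=
  ∃ E F : ℝ → Proj A, IsSpectralFamilyOf (x : A) E ∧ IsSpectralFamilyOf (y : A) F ∧
    ∀ t : ℝ, F t ≤ E t

variable {B : Type*} [Ring B] [StarRing B] [Algebra ℂ B]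

/-- A spectral order isomorphism between self-adjoint parts: a bijection preserving the spectral
order in both directions. -/
structure IsSpectralOrderIso (Φ : selfAdjoint A → selfAdjoint B) : Prop where
  bijective : Function.Bijective Φ
  le_iff : ∀ x y : selfAdjoint A, SpectralLE x y ↔ SpectralLE (Φ x) (Φ y)

/-- The graph of the map `Θ_τ` attached to an isomorphism `τ` of projection lattices:
`IsTheta τ x y` says that `y = Θ_τ(x)`, that is, `E^y_t = τ(E^x_t)` for every real `t`. -/
def IsTheta (τ : Proj A ≃o Proj B) (x : A) (y : B) : Prop :=
  ∃ E : ℝ → Proj A, IsSpectralFamilyOf x E ∧ IsSpectralFamilyOf y (fun t => τ (E t))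

end General

/-- The algebra `B(ℂⁿ)` of all bounded operators on the Hilbert space `ℂⁿ`. -/
abbrev MatAlg (n : ℕ) : Type := EuclideanSpace ℂ (Fin n) →L[ℂ] EuclideanSpace ℂ (Fin n)

/-- The C*-algebraic direct sum `⨁_j B(ℂ^{m_j})`: all families with bounded operator norms, with
the pointwise *-algebra operations and the supremum norm. -/
def MatSum {ι : Type*} (m : ι → ℕ) : Type _ := lp (fun j => MatAlg (m j)) ∞

namespace MatSum

variable {ι : Type*} (m : ι → ℕ)

instance instCoeFun : CoeFun (MatSum m) (fun _ => ∀ j, MatAlg (m j)) := ⟨fun x => x.1⟩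

variable [∀ j, NeZero (m j)]

instance instRing : Ring (MatSum m) := lp.inftyRing

instance instAlgebra : Algebra ℂ (MatSum m) :=
  inferInstanceAs (Algebra ℂ (lp (fun j => MatAlg (m j)) ∞))

instance instStarRing : StarRing (MatSum m) where
  star x := ⟨fun j => star (x j), (star (show lp (fun j => MatAlg (m j)) ∞ from x)).2⟩
  star_involutive x := Subtype.ext (funext fun j => star_star (x j))
  star_mul x y := Subtype.ext (funext fun j => star_mul (x j) (y j))
  star_add x y := Subtype.ext (funext fun j => star_add (x j) (y j))

theorem one_apply (j : ι) : (1 : MatSum m) j = 1 := rfl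

theorem add_apply (x y : MatSum m) (j : ι) : (x + y) j = x j + y j := rfl

theorem mul_apply (x y : MatSum m) (j : ι) : (x * y) j = x j * y j := rfl

theorem smul_apply (c : ℂ) (x : MatSum m) (j : ι) : (c • x) j = c • x j := rfl

theorem star_apply (x : MatSum m) (j : ι) : (star x) j = star (x j) := rfl

end MatSum

/-- The identification of `B(ℂⁿ)` with `B(ℂᵐ)` when `n = m`. -/
def matCast {n m : ℕ} (h : n = m) (a : MatAlg n) : MatAlg m := h ▸ a

end

/-!
A self-adjoint element `x` of `⨁_j B(ℂ^{m_j})` is the same thing as its family of spectral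
projections at each index, and the spectral order is the reversed pointwise order of these. The
proof reads off the data of `x` from this order alone, and a spectral order isomorphism `Φ`
transports whatever is read off.

* *Central elements.* Those `z` such that any `x` is determined by `x ⊓ z` and `x ⊔ z` are exactly
  the families of scalars (`SpectralModel.cancel_iff_exists_eq_cen`): a proper nonzero subspace has
  two distinct complements, and these would give two elements that `z` does not separate. So `Φ`
  restricts to an order isomorphism between lattices of bounded real functions on the two index
  sets. Such a map acts coordinatewise, through a bijection `σ` of the index sets and increasing
  bijections `f j` of `ℝ` (`BddFun.exists_equiv_forall_apply`), since two bounded functions differ at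
  a single index exactly when the interval between them is a chain.
* *Two-valued elements.* Let `c ≤ d` be central and differ at the index `j` only. By modularity of
  the lattice of subspaces, the complemented elements of the interval `[c, d]` are those which at `j`
  equal `c j` on a subspace `p` and `d j` on its orthogonal complement, and agree with `c` elsewhere
  (`SpectralModel.isRelCompl_single`, `SpectralModel.exists_eq_single`). Hence `Φ` induces a lattice
  isomorphism `p ↦ T p`. Comparing such elements over overlapping intervals shows that `T` depends
  on `j` only.
* *All elements.* A subspace `p` lies below the spectral projection of `x` at `j` and `t` if and only
  if `x` lies below the element that at `j` is `t` on `p` and a large `N` on its complement, and is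
  `N` at all other indices. Applying `Φ` gives
  `E^{Φ x}_{f t} = T (E^x_t)` (`SpectralModel.exists_forall_E_map`).

This argument is carried out for the abstract structure `SpectralModel`. For matrices, all spectral
data come from the functional calculus, which applies to arbitrary functions because spectra are
finite; a spectral family of `x` is unique because its values on the eigenvectors of `x` are forced
(`IsSpectralFamilyOf.apply_eigenvector`). Finally `m j = n (σ j)` because isomorphic subspace
lattices have the same length.
-/

noncomputable section

/-! ### Order isomorphisms between lattices of bounded functions -/

/-- The bounded real functions on a set, with the pointwise order. -/
abbrev BddFun (ι : Type*) := {c : ι → ℝ // ∃ α, ∀ j, |c j| ≤ α}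

namespace BddFun

variable {ι κ : Type*}

instance : Lattice (BddFun ι) :=
  Subtype.lattice
    (fun _ _ ⟨α, hα⟩ ⟨β, hβ⟩ =>
      ⟨max α β, fun j => abs_max_le_max_abs_abs.trans (max_le_max (hα j) (hβ j))⟩)
    (fun _ _ ⟨α, hα⟩ ⟨β, hβ⟩ =>
      ⟨max α β, fun j => abs_min_le_max_abs_abs.trans (max_le_max (hα j) (hβ j))⟩)

theorem sup_apply (c d : BddFun ι) (j : ι) : (c ⊔ d).1 j = max (c.1 j) (d.1 j) := rfl

theorem inf_apply (c d : BddFun ι) (j : ι) : (c ⊓ d).1 j = min (c.1 j) (d.1 j) := rfl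

/-- The constant function. -/
def const (ι : Type*) (a : ℝ) : BddFun ι := ⟨fun _ => a, |a|, fun _ => le_rfl⟩

open scoped Classical in
/-- The function `c` with its value at `j` replaced by `a`. -/
def update (c : BddFun ι) (j : ι) (a : ℝ) : BddFun ι :=
  ⟨Function.update c.1 j a, by
    obtain ⟨α, hα⟩ := c.2
    refine ⟨max α |a|, fun i => ?_⟩
    by_cases h : i = j
    · subst h; simp
    · simp [h, hα i]⟩

@[simp] theorem const_apply (a : ℝ) (j : ι) : (const ι a).1 j = a := rfl

@[simp] theorem update_self (c : BddFun ι) (j : ι) (a : ℝ) : (c.update j a).1 j = a := by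
  simp [update]

theorem update_of_ne (c : BddFun ι) {i j : ι} (h : i ≠ j) (a : ℝ) :
    (c.update j a).1 i = c.1 i := by
  simp [update, h]

/-- `u` and `v` agree except at `j`, where `u` is strictly smaller. -/
def StepAt (j : ι) (u v : BddFun ι) : Prop := u.1 j < v.1 j ∧ ∀ i, i ≠ j → u.1 i = v.1 i

theorem StepAt.le {j : ι} {u v : BddFun ι} (h : StepAt j u v) : u ≤ v := fun i => by
  by_cases hi : i = j
  · subst hi; exact h.1.le
  · exact (h.2 i hi).le

theorem StepAt.eq {i j : ι} {u v : BddFun ι} (h : StepAt j u v) (h' : u.1 i ≠ v.1 i) : i = j := by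
  by_contra hi
  exact h' (h.2 i hi)

theorem stepAt_update (c : BddFun ι) (j : ι) {a b : ℝ} (h : a < b) :
    StepAt j (c.update j a) (c.update j b) :=
  ⟨by simpa using h, fun i hi => by rw [update_of_ne c hi, update_of_ne c hi]⟩

theorem update_eq_self (u : BddFun ι) (j : ι) : u.update j (u.1 j) = u := by
  refine Subtype.ext (funext fun i => ?_)
  by_cases hi : i = j
  · subst hi; simp
  · rw [update_of_ne u hi]

/-- Changing a single coordinate is a notion of the order alone: it means that the interval
between the two functions is a chain. -/
theorem exists_stepAt_iff (u v : BddFun ι) :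
    (∃ j, StepAt j u v) ↔ u < v ∧ ∀ x y, u ≤ x → x ≤ v → u ≤ y → y ≤ v → x ≤ y ∨ y ≤ x := by
  constructor
  · rintro ⟨j, hj⟩
    refine ⟨lt_of_le_of_ne hj.le fun h => hj.1.ne (by rw [h]), fun x y hux hxv huy hyv => ?_⟩
    have key : ∀ x y : BddFun ι, u ≤ x → x ≤ v → u ≤ y → y ≤ v → x.1 j ≤ y.1 j → x ≤ y := by
      intro x y _ hxv huy _ h i
      by_cases hi : i = j
      · subst hi; exact h
      · exact (hxv i).trans ((hj.2 i hi).ge.trans (huy i))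
    exact (le_total (x.1 j) (y.1 j)).imp (key x y hux hxv huy hyv) (key y x huy hyv hux hxv)
  · rintro ⟨huv, hch⟩
    obtain ⟨j, hj⟩ : ∃ j, u.1 j < v.1 j := by
      by_contra! h
      exact huv.not_ge h
    refine ⟨j, hj, fun i hi => le_antisymm (huv.le i) ?_⟩
    by_contra! hlt
    have hb : ∀ k, u ≤ u.update k (v.1 k) ∧ u.update k (v.1 k) ≤ v := by
      refine fun k => ⟨fun l => ?_, fun l => ?_⟩
      · by_cases hl : l = k
        · subst hl; simpa using huv.le l
        · rw [update_of_ne u hl]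
      · by_cases hl : l = k
        · subst hl; simp
        · rw [update_of_ne u hl]; exact huv.le l
    rcases hch _ _ (hb j).1 (hb j).2 (hb i).1 (hb i).2 with h | h
    · have := h j
      rw [update_self, update_of_ne u (Ne.symm hi)] at this
      exact this.not_gt hj
    · have := h i
      rw [update_self, update_of_ne u hi] at this
      exact this.not_gt hlt

theorem exists_stepAt_map (ψ : BddFun ι ≃o BddFun κ) {j : ι} {u v : BddFun ι} (h : StepAt j u v) :
    ∃ k, StepAt k (ψ u) (ψ v) := by
  obtain ⟨huv, hch⟩ := (exists_stepAt_iff u v).1 ⟨j, h⟩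
  refine (exists_stepAt_iff _ _).2 ⟨ψ.lt_iff_lt.2 huv, fun x y h1 h2 h3 h4 => ?_⟩
  have := hch (ψ.symm x) (ψ.symm y) (ψ.le_symm_apply.2 h1) (ψ.symm_apply_le.2 h2)
    (ψ.le_symm_apply.2 h3) (ψ.symm_apply_le.2 h4)
  simpa using this

theorem stepAt_map_eq_of_le {ψ : BddFun ι ≃o BddFun κ} {u v u' v' : BddFun ι} {k k' : κ}
    (h : StepAt k (ψ u) (ψ v)) (h' : StepAt k' (ψ u') (ψ v')) (hu : u ≤ u') (hv : v' ≤ v) :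
    k' = k :=
  h.eq (((ψ.monotone hu) k').trans_lt (h'.1.trans_le ((ψ.monotone hv) k'))).ne

theorem stepAt_map_eq_of_inf_sup {ψ : BddFun ι ≃o BddFun κ} {u v u' v' : BddFun ι} {k k' : κ}
    (h : StepAt k (ψ u) (ψ v)) (h' : StepAt k' (ψ u') (ψ v')) (hu : u = v ⊓ u')
    (hv : v' = v ⊔ u') : k = k' := by
  have h1 : (ψ u).1 k = min ((ψ v).1 k) ((ψ u').1 k) := by
    rw [hu, ψ.map_inf]; rfl
  have h2 : (ψ v').1 k = max ((ψ v).1 k) ((ψ u').1 k) := by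
    rw [hv, ψ.map_sup]; rfl
  refine h'.eq (ne_of_lt ?_)
  have h3 := h.1
  rw [h1, min_lt_iff] at h3
  rw [h2, lt_max_iff]
  exact Or.inl (h3.resolve_left (lt_irrefl _))

theorem stepAt_map_unique {ψ : BddFun ι ≃o BddFun κ} {j : ι} {u v u' v' : BddFun ι} {k k' : κ}
    (huv : StepAt j u v) (huv' : StepAt j u' v')
    (h : StepAt k (ψ u) (ψ v)) (h' : StepAt k' (ψ u') (ψ v')) : k = k' := by
  -- Widen both pairs to the same range at `j`, then lower both to the common minorant `u ⊓ u'`.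
  set a := min (u.1 j) (u'.1 j) with ha
  set b := max (v.1 j) (v'.1 j) with hb
  have hab : a < b := (min_le_left _ _).trans_lt (huv.1.trans_le (le_max_left _ _))
  have widen : ∀ {w z : BddFun ι} {l l' : κ}, StepAt j w z → a ≤ w.1 j → z.1 j ≤ b →
      StepAt l (ψ w) (ψ z) → StepAt l' (ψ (w.update j a)) (ψ (w.update j b)) → l = l' := by
    intro w z l l' hwz haw hzb hl hl'
    refine stepAt_map_eq_of_le hl' hl (fun i => ?_) (fun i => ?_)
    · by_cases hi : i = j
      · subst hi; simpa using haw
      · rw [update_of_ne w hi]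
    · by_cases hi : i = j
      · subst hi; simpa using hzb
      · rw [update_of_ne w hi, hwz.2 i hi]
  have lower : ∀ {m w : BddFun ι} {l l' : κ}, m ≤ w →
      StepAt l (ψ (m.update j a)) (ψ (m.update j b)) →
      StepAt l' (ψ (w.update j a)) (ψ (w.update j b)) → l = l' := by
    intro m w l l' hmw hl hl'
    refine stepAt_map_eq_of_inf_sup hl hl' (Subtype.ext (funext fun i => ?_))
      (Subtype.ext (funext fun i => ?_))
    · rw [inf_apply]
      by_cases hi : i = j
      · subst hi; simpa using hab.le
      · rw [update_of_ne m hi, update_of_ne m hi, update_of_ne w hi]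
        exact (min_eq_left (hmw i)).symm
    · rw [sup_apply]
      by_cases hi : i = j
      · subst hi; simpa using hab.le
      · rw [update_of_ne m hi, update_of_ne w hi, update_of_ne w hi]
        exact (max_eq_right (hmw i)).symm
  obtain ⟨k₁, hk₁⟩ := exists_stepAt_map ψ (stepAt_update u j hab)
  obtain ⟨k₂, hk₂⟩ := exists_stepAt_map ψ (stepAt_update u' j hab)
  obtain ⟨k₀, hk₀⟩ := exists_stepAt_map ψ (stepAt_update (u ⊓ u') j hab)
  rw [widen huv (min_le_left _ _) (le_max_left _ _) h hk₁,
    widen huv' (min_le_right _ _) (le_max_right _ _) h' hk₂,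
    ← lower inf_le_left hk₀ hk₁, ← lower inf_le_right hk₀ hk₂]

theorem exists_index_map (ψ : BddFun ι ≃o BddFun κ) :
    ∃ σ : ι → κ, ∀ j u v, StepAt j u v → StepAt (σ j) (ψ u) (ψ v) := by
  choose σ hσ using fun j : ι => exists_stepAt_map ψ (stepAt_update (const ι 0) j zero_lt_one)
  refine ⟨σ, fun j u v h => ?_⟩
  obtain ⟨k, hk⟩ := exists_stepAt_map ψ h
  rwa [stepAt_map_unique (stepAt_update (const ι 0) j zero_lt_one) h (hσ j) hk]

/-- An order isomorphism between lattices of bounded functions acts coordinatewise, up to a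
bijection of the index sets. -/
theorem exists_equiv_forall_apply (ψ : BddFun ι ≃o BddFun κ) :
    ∃ (σ : ι ≃ κ) (f : ι → ℝ ≃o ℝ), ∀ c j, (ψ c).1 (σ j) = f j (c.1 j) := by
  obtain ⟨σ, hσ⟩ := exists_index_map ψ
  obtain ⟨ρ, hρ⟩ := exists_index_map ψ.symm
  have hρσ : ∀ j, ρ (σ j) = j := fun j => by
    have h := stepAt_update (const ι 0) j zero_lt_one
    have h' := hρ _ _ _ (hσ j _ _ h)
    simp only [OrderIso.symm_apply_apply] at h'
    exact h.eq h'.1.ne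
  have hσρ : ∀ k, σ (ρ k) = k := fun k => by
    have h := stepAt_update (const κ 0) k zero_lt_one
    have h' := hσ _ _ _ (hρ k _ _ h)
    simp only [OrderIso.apply_symm_apply] at h'
    exact h.eq h'.1.ne
  have mono : ∀ (x y : BddFun ι) j, x ≤ y → x.1 j = y.1 j → (ψ x).1 (σ j) = (ψ y).1 (σ j) := by
    intro x y j hxy hj
    refine le_antisymm (ψ.monotone hxy _) ?_
    by_contra! hlt
    -- Raise only the coordinate `σ j` of `ψ x`: its preimage lies in `[x, y]` and exceeds `x` at `j`.
    have hs := stepAt_update (ψ x) (σ j) hlt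
    rw [update_eq_self] at hs
    have h := hρ _ _ _ hs
    rw [OrderIso.symm_apply_apply, hρσ] at h
    have hle : (ψ x).update (σ j) ((ψ y).1 (σ j)) ≤ ψ y := fun k => by
      by_cases hk : k = σ j
      · subst hk; simp
      · rw [update_of_ne _ hk]; exact ψ.monotone hxy k
    exact (h.1.trans_le ((ψ.symm_apply_le.2 hle) j)).ne hj
  have coord : ∀ (x y : BddFun ι) j, x.1 j = y.1 j → (ψ x).1 (σ j) = (ψ y).1 (σ j) := by
    intro x y j hj
    have h : (x ⊓ y).1 j = x.1 j := by rw [inf_apply, hj, min_self]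
    rw [← mono (x ⊓ y) x j inf_le_left h, ← mono (x ⊓ y) y j inf_le_right (h.trans hj)]
  have hmono : ∀ j, StrictMono fun a => (ψ (const ι a)).1 (σ j) := by
    intro j a b hab
    have h := stepAt_update (const ι a) j hab
    have h' := (hσ _ _ _ h).1
    dsimp only
    rwa [coord ((const ι a).update j a) (const ι a) j (by simp),
      coord ((const ι a).update j b) (const ι b) j (by simp)] at h'
  have hsurj : ∀ j, Function.Surjective fun a => (ψ (const ι a)).1 (σ j) := by
    intro j s
    refine ⟨(ψ.symm (const κ s)).1 j, ?_⟩
    dsimp only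
    rw [coord _ (ψ.symm (const κ s)) j (by simp)]
    simp
  exact ⟨⟨σ, ρ, hρσ, hσρ⟩, fun j => (hmono j).orderIsoOfSurjective _ (hsurj j),
    fun c j => coord c (const ι (c.1 j)) j rfl⟩

end BddFun

/-! ### Ordered families of bounded spectral resolutions -/

/-- An abstract form of the self-adjoint part of a direct sum of matrix algebras: every `x : X` has
at each index `j` a spectral family `E x j` in a lattice `L j`, uniformly bounded in `j`, and all
uniformly bounded families with at most two spectral values per index occur. Right continuity is
phrased as being constant on some `[t, s]` with `t < s`, which is what it amounts to in lattices
of finite length. -/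
structure SpectralModel {ι : Type*} (L : ι → Type*) [∀ j, Lattice (L j)]
    [∀ j, BoundedOrder (L j)] (X : Type*) where
  E : X → ∀ j, ℝ → L j
  injective : ∀ x y, (∀ j t, E x j t = E y j t) → x = y
  mono : ∀ x j s t, s ≤ t → E x j s ≤ E x j t
  right : ∀ x j t, ∃ s, t < s ∧ E x j s = E x j t
  bounded : ∀ x, ∃ α, ∀ j, (∀ t < -α, E x j t = ⊥) ∧ ∀ t, α ≤ t → E x j t = ⊤
  exists_step : ∀ a b : BddFun ι, a ≤ b → ∀ p : ∀ j, L j,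
    ∃ x, ∀ j t, E x j t = if t < a.1 j then ⊥ else if t < b.1 j then p j else ⊤

namespace SpectralModel

variable {ι : Type*} {L : ι → Type*} [∀ j, Lattice (L j)] [∀ j, BoundedOrder (L j)] {X : Type*}
  (M : SpectralModel L X)

/-- The spectral order. -/
def le (x y : X) : Prop := ∀ j t, M.E y j t ≤ M.E x j t

/-- The element with spectral values `a j ≤ b j` at `j`, where `p j` is the spectral projection for
`a j`. In order that it be defined for all `a` and `b`, the upper value is taken to be
`(a ⊔ b) j`. -/
def step (a b : BddFun ι) (p : ∀ j, L j) : X :=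
  (M.exists_step a (a ⊔ b) le_sup_left p).choose

theorem E_step {a b : BddFun ι} (hab : a ≤ b) (p : ∀ j, L j) (j : ι) (t : ℝ) :
    M.E (M.step a b p) j t = if t < a.1 j then ⊥ else if t < b.1 j then p j else ⊤ := by
  have h := (M.exists_step a (a ⊔ b) le_sup_left p).choose_spec j t
  have hb : (a ⊔ b).1 j = b.1 j := max_eq_right (hab j)
  rwa [hb] at h

theorem le_step {a b : BddFun ι} (hab : a ≤ b) (p : ∀ j, L j) (x : X) :
    M.le x (M.step a b p) ↔
      ∀ i, (a.1 i < b.1 i → p i ≤ M.E x i (a.1 i)) ∧ M.E x i (b.1 i) = ⊤ := by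
  constructor
  · refine fun h i => ⟨fun hi => ?_, ?_⟩
    · simpa [M.E_step hab, hi] using h i (a.1 i)
    · simpa [M.E_step hab, (hab i).not_gt] using h i (b.1 i)
  · intro h i t
    rw [M.E_step hab]
    split_ifs with h1 h2
    · exact bot_le
    · exact ((h i).1 ((not_lt.1 h1).trans_lt h2)).trans (M.mono _ _ _ _ (not_lt.1 h1))
    · exact (h i).2.ge.trans (M.mono _ _ _ _ (not_lt.1 h2))

theorem step_le {a b : BddFun ι} (hab : a ≤ b) (p : ∀ j, L j) (x : X) :
    M.le (M.step a b p) x ↔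
      ∀ i, (∀ t < a.1 i, M.E x i t = ⊥) ∧ ∀ t < b.1 i, M.E x i t ≤ p i := by
  constructor
  · refine fun h i => ⟨fun t ht => ?_, fun t ht => ?_⟩
    · simpa [M.E_step hab, ht] using h i t
    · have := h i t
      rw [M.E_step hab] at this
      split_ifs at this with h1
      · exact this.trans bot_le
      · exact this
  · intro h i t
    rw [M.E_step hab]
    split_ifs with h1 h2
    · exact ((h i).1 t h1).le
    · exact (h i).2 t h2
    · exact le_top

/-- The central element given by a bounded function. -/
def cen (c : BddFun ι) : X := M.step c c fun _ => ⊥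

theorem E_cen (c : BddFun ι) (j : ι) (t : ℝ) :
    M.E (M.cen c) j t = if t < c.1 j then ⊥ else ⊤ := by
  rw [cen, M.E_step le_rfl]
  split_ifs <;> rfl

theorem le_cen (c : BddFun ι) (x : X) : M.le x (M.cen c) ↔ ∀ i, M.E x i (c.1 i) = ⊤ := by
  simp [cen, M.le_step le_rfl]

theorem cen_le (c : BddFun ι) (x : X) : M.le (M.cen c) x ↔ ∀ i, ∀ t < c.1 i, M.E x i t = ⊥ := by
  simp [cen, M.step_le le_rfl]

theorem cen_le_cen [∀ j, Nontrivial (L j)] {c d : BddFun ι} :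
    M.le (M.cen c) (M.cen d) ↔ c ≤ d := by
  rw [le_cen]
  refine forall_congr' fun i => ?_
  rw [E_cen]
  split_ifs with h
  · simpa using h
  · simpa using h

theorem cen_injective [∀ j, Nontrivial (L j)] : Function.Injective M.cen := fun _ _ h =>
  le_antisymm (M.cen_le_cen.1 fun _ _ => by rw [h]) (M.cen_le_cen.1 fun _ _ => by rw [h])

open scoped Classical in
/-- The element `step` with a non-scalar value at the index `j` only. -/
def single (c : BddFun ι) (j : ι) (β : ℝ) (p : L j) : X :=
  M.step c (c.update j β) (Function.update (fun _ => ⊥) j p)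

theorem le_update {c : BddFun ι} {j : ι} {β : ℝ} (h : c.1 j < β) : c ≤ c.update j β := fun i => by
  by_cases hi : i = j
  · subst hi; simpa using h.le
  · rw [BddFun.update_of_ne c hi]

theorem E_single_self {c : BddFun ι} {j : ι} {β : ℝ} (h : c.1 j < β) (p : L j) (t : ℝ) :
    M.E (M.single c j β p) j t = if t < c.1 j then ⊥ else if t < β then p else ⊤ := by
  rw [single, M.E_step (le_update h)]
  simp

theorem le_single {c : BddFun ι} {j : ι} {β : ℝ} (h : c.1 j < β) (p : L j) (x : X) :
    M.le x (M.single c j β p) ↔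
      p ≤ M.E x j (c.1 j) ∧ M.E x j β = ⊤ ∧ ∀ i, i ≠ j → M.E x i (c.1 i) = ⊤ := by
  rw [single, M.le_step (le_update h)]
  constructor
  · refine fun H => ⟨?_, ?_, fun i hi => ?_⟩
    · simpa [h] using (H j).1
    · simpa using (H j).2
    · simpa [BddFun.update_of_ne c hi] using (H i).2
  · rintro ⟨h1, h2, h3⟩ i
    by_cases hi : i = j
    · subst hi; simpa [h] using ⟨h1, h2⟩
    · simpa [BddFun.update_of_ne c hi] using h3 i hi

theorem single_le {c : BddFun ι} {j : ι} {β : ℝ} (h : c.1 j < β) (p : L j) (x : X) :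
    M.le (M.single c j β p) x ↔
      (∀ i, ∀ t < c.1 i, M.E x i t = ⊥) ∧ ∀ t < β, M.E x j t ≤ p := by
  rw [single, M.step_le (le_update h)]
  constructor
  · exact fun H => ⟨fun i => (H i).1, by simpa using (H j).2⟩
  · rintro ⟨h1, h2⟩ i
    refine ⟨h1 i, ?_⟩
    by_cases hi : i = j
    · subst hi; simpa using h2
    · rw [BddFun.update_of_ne c hi]
      exact fun t ht => (h1 i t ht).le.trans bot_le

theorem single_le_single {c d : BddFun ι} {j : ι} {β β' : ℝ} (hcd : c ≤ d) (hd : d.1 j < β)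
    (hβ : β ≤ β') (p q : L j) :
    M.le (M.single c j β p) (M.single d j β' q) ↔ q ≤ p := by
  have hc : c.1 j < β := (hcd j).trans_lt hd
  rw [M.le_single (hd.trans_le hβ), M.E_single_self hc, M.E_single_self hc,
    if_neg (hcd j).not_gt, if_pos hd, if_neg (hd.trans_le hβ |>.trans_le' (hcd j)).not_gt,
    if_neg hβ.not_gt]
  refine ⟨fun h => h.1, fun h => ⟨h, rfl, fun i hi => ?_⟩⟩
  rw [single, M.E_step (le_update hc), BddFun.update_of_ne c hi]
  simp [(hcd i).not_gt]

theorem exists_bound (x y : X) (s : ℝ) :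
    ∃ N, s < N ∧ -N < s ∧ (∀ j, ∀ t < -N, M.E x j t = ⊥) ∧ (∀ j, M.E x j N = ⊤) ∧
      (∀ j, ∀ t < -N, M.E y j t = ⊥) ∧ ∀ j, M.E y j N = ⊤ := by
  obtain ⟨α, hα⟩ := M.bounded x
  obtain ⟨β, hβ⟩ := M.bounded y
  refine ⟨max (max α β) (|s| + 1), ?_, ?_, fun j t ht => (hα j).1 t ?_, fun j => (hα j).2 _ ?_,
    fun j t ht => (hβ j).1 t ?_, fun j => (hβ j).2 _ ?_⟩
  · exact lt_max_of_lt_right ((le_abs_self s).trans_lt (lt_add_one _))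
  · have : |s| + 1 ≤ max (max α β) (|s| + 1) := le_max_right _ _
    linarith [neg_abs_le s]
  · have : α ≤ max (max α β) (|s| + 1) := (le_max_left _ _).trans (le_max_left _ _)
    linarith
  · exact (le_max_left _ _).trans (le_max_left _ _)
  · have : β ≤ max (max α β) (|s| + 1) := (le_max_right _ _).trans (le_max_left _ _)
    linarith
  · exact (le_max_right _ _).trans (le_max_left _ _)

theorem exists_right (x y : X) (j : ι) (t : ℝ) :
    ∃ s, t < s ∧ M.E x j s = M.E x j t ∧ M.E y j s = M.E y j t := by
  obtain ⟨s, hs, hxs⟩ := M.right x j t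
  obtain ⟨r, hr, hyr⟩ := M.right y j t
  refine ⟨min s r, lt_min hs hr, le_antisymm ?_ (M.mono _ _ _ _ (lt_min hs hr).le),
    le_antisymm ?_ (M.mono _ _ _ _ (lt_min hs hr).le)⟩
  · exact (M.mono _ _ _ _ (min_le_left _ _)).trans hxs.le
  · exact (M.mono _ _ _ _ (min_le_right _ _)).trans hyr.le

/-! ### Central elements -/

/-- `z` is cancellable: an element is determined by its infimum and its supremum with `z`. The
condition is spelled out in terms of lower and upper bounds. -/
def Cancel (z : X) : Prop :=
  ∀ x y, (∀ w, M.le w z → (M.le w x ↔ M.le w y)) → (∀ w, M.le z w → (M.le x w ↔ M.le y w)) → x = y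

theorem cancel_of_central {z : X} (hz : ∀ j t, M.E z j t = ⊥ ∨ M.E z j t = ⊤) : M.Cancel z := by
  have key : ∀ x y, (∀ w, M.le w z → (M.le w x ↔ M.le w y)) →
      (∀ w, M.le z w → (M.le x w ↔ M.le y w)) → ∀ j t,
      (M.E z j t = ⊥ → M.E y j t ≤ M.E x j t) ∧ (M.E z j t = ⊤ → M.E x j t ≤ M.E y j t) := by
    intro x y hl hu j t
    refine ⟨fun h0 => ?_, fun h1 => ?_⟩
    · obtain ⟨s, hts, hxs, hzs⟩ := M.exists_right x z j t
      obtain ⟨N, -, hNs, hx, -, hz', -⟩ := M.exists_bound x z s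
      have hc : (BddFun.const ι (-N)).1 j < s := hNs
      have H := (hl (M.single (BddFun.const ι (-N)) j s (M.E x j t)) ?_).1 ?_
      · exact ((M.single_le hc _ _).1 H).2 t hts
      · refine (M.single_le hc _ _).2 ⟨hz', fun r hr => ?_⟩
        exact (M.mono _ _ _ _ hr.le).trans (hzs.trans h0 |>.le.trans bot_le)
      · exact (M.single_le hc _ _).2 ⟨hx, fun r hr => (M.mono _ _ _ _ hr.le).trans hxs.le⟩
    · obtain ⟨N, hN, -, -, hx, -, hz'⟩ := M.exists_bound x z t
      have hc : ((BddFun.const ι N).update j t).1 j < N := by simpa using hN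
      have H := (hu (M.single ((BddFun.const ι N).update j t) j N (M.E x j t)) ?_).1 ?_
      · simpa using ((M.le_single hc _ _).1 H).1
      · refine (M.le_single hc _ _).2 ⟨by simp [h1], hz' j, fun i hi => ?_⟩
        rw [BddFun.update_of_ne _ hi]; exact hz' i
      · refine (M.le_single hc _ _).2 ⟨by simp, hx j, fun i hi => ?_⟩
        rw [BddFun.update_of_ne _ hi]; exact hx i
  intro x y hl hu
  refine M.injective x y fun j t => ?_
  have h := key x y hl hu j t
  have h' := key y x (fun w hw => (hl w hw).symm) (fun w hw => (hu w hw).symm) j t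
  rcases hz j t with h0 | h1
  · exact le_antisymm (h'.1 h0) (h.1 h0)
  · exact le_antisymm (h.2 h1) (h'.2 h1)

/-- If a spectral projection of `z` has two distinct complements, then these give two elements with
the same infimum and the same supremum with `z`. -/
theorem central_of_cancel
    (hL : ∀ j (p : L j), p ≠ ⊥ → p ≠ ⊤ → ∃ q r, q ≠ r ∧ IsCompl p q ∧ IsCompl p r)
    {z : X} (hz : M.Cancel z) (j : ι) (t : ℝ) : M.E z j t = ⊥ ∨ M.E z j t = ⊤ := by
  by_contra! hp
  obtain ⟨q, r, hqr, hq, hr⟩ := hL j _ hp.1 hp.2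
  obtain ⟨s, hts, hs⟩ := M.right z j t
  set c := (BddFun.const ι 0).update j t with hcdef
  have hcj : c.1 j = t := by simp [hcdef]
  have hc : c.1 j < s := by rwa [hcj]
  have low : ∀ q r : L j, IsCompl (M.E z j t) q → ∀ w, M.le w z →
      M.le w (M.single c j s q) → M.le w (M.single c j s r) := by
    intro q r hq w hwz hw
    rw [M.le_single hc] at hw ⊢
    refine ⟨?_, hw.2⟩
    have h := sup_le (hwz j t) (hcj ▸ hw.1)
    rw [hq.sup_eq_top, top_le_iff] at h
    rw [hcj, h]
    exact le_top
  have upp : ∀ q r : L j, IsCompl (M.E z j t) q → ∀ w, M.le z w →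
      M.le (M.single c j s q) w → M.le (M.single c j s r) w := by
    intro q r hq w hzw hw
    rw [M.single_le hc] at hw ⊢
    refine ⟨hw.1, fun u hu => ?_⟩
    have h := le_inf (((hzw j u).trans (M.mono _ _ _ _ hu.le)).trans hs.le) (hw.2 u hu)
    exact (h.trans hq.inf_eq_bot.le).trans bot_le
  have h := hz (M.single c j s q) (M.single c j s r)
    (fun w hw => ⟨low q r hq w hw, low r q hr w hw⟩)
    (fun w hw => ⟨upp q r hq w hw, upp r q hr w hw⟩)
  have h' := congrArg (fun x => M.E x j t) h
  simp only [M.E_single_self hc, hcj, lt_irrefl, if_false, if_pos hts] at h'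
  exact hqr h'

theorem exists_eq_cen [∀ j, Nontrivial (L j)] {z : X}
    (hz : ∀ j t, M.E z j t = ⊥ ∨ M.E z j t = ⊤) : ∃ c, z = M.cen c := by
  obtain ⟨α, hα⟩ := M.bounded z
  set S : ι → Set ℝ := fun j => {t | M.E z j t = ⊤} with hS
  have hne : ∀ j, (S j).Nonempty := fun j => ⟨α, (hα j).2 α le_rfl⟩
  have hlow : ∀ j, ∀ t ∈ S j, -α ≤ t := fun j t ht => by
    by_contra! h
    exact bot_ne_top (((hα j).1 t h).symm.trans ht)
  have hbdd : ∀ j, BddBelow (S j) := fun j => ⟨-α, hlow j⟩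
  have hmem : ∀ j, sInf (S j) ∈ S j := fun j => by
    obtain ⟨s, hs, hE⟩ := M.right z j (sInf (S j))
    obtain ⟨t, ht, hts⟩ := exists_lt_of_csInf_lt (hne j) hs
    have : M.E z j s = ⊤ := top_le_iff.1 ((show M.E z j t = ⊤ from ht).ge.trans
      (M.mono _ _ _ _ hts.le))
    exact hE.symm.trans this
  refine ⟨⟨fun j => sInf (S j), α, fun j => abs_le.2 ⟨le_csInf (hne j) (hlow j),
    csInf_le (hbdd j) ((hα j).2 α le_rfl)⟩⟩, M.injective _ _ fun j t => ?_⟩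
  rw [E_cen]
  split_ifs with h
  · exact (hz j t).resolve_right fun h' => (csInf_le (hbdd j) h').not_gt h
  · exact top_le_iff.1 ((show M.E z j _ = ⊤ from hmem j).ge.trans (M.mono _ _ _ _ (not_lt.1 h)))

theorem cancel_iff_exists_eq_cen [∀ j, Nontrivial (L j)]
    (hL : ∀ j (p : L j), p ≠ ⊥ → p ≠ ⊤ → ∃ q r, q ≠ r ∧ IsCompl p q ∧ IsCompl p r) (z : X) :
    M.Cancel z ↔ ∃ c, z = M.cen c := by
  refine ⟨fun h => M.exists_eq_cen (M.central_of_cancel hL h), ?_⟩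
  rintro ⟨c, rfl⟩
  refine M.cancel_of_central fun j t => ?_
  rw [E_cen]
  split_ifs <;> simp

/-! ### Complemented elements of intervals between central elements -/

/-- `x` is complemented in the interval from `a` to `b`. -/
def IsRelCompl (a b x : X) : Prop :=
  M.le a x ∧ M.le x b ∧ ∃ y, M.le a y ∧ M.le y b ∧
    (∀ w, M.le w x → M.le w y → M.le w a) ∧ ∀ w, M.le x w → M.le y w → M.le b w

theorem isRelCompl_single [∀ j, ComplementedLattice (L j)] {c : BddFun ι} {j : ι} {β : ℝ}
    (h : c.1 j < β) (p : L j) :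
    M.IsRelCompl (M.cen c) (M.cen (c.update j β)) (M.single c j β p) := by
  obtain ⟨q, hq⟩ := exists_isCompl p
  have hmem : ∀ p : L j, M.le (M.cen c) (M.single c j β p) ∧
      M.le (M.single c j β p) (M.cen (c.update j β)) := by
    refine fun p => ⟨(M.cen_le _ _).2 fun i t ht => ?_, (M.le_cen _ _).2 fun i => ?_⟩
    · rw [single, M.E_step (le_update h), if_pos ht]
    · rw [single, M.E_step (le_update h), if_neg (le_update h i).not_gt, if_neg (lt_irrefl _)]
  refine ⟨(hmem p).1, (hmem p).2, M.single c j β q, (hmem q).1, (hmem q).2,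
    fun w hwp hwq => ?_, fun w hwp hwq => ?_⟩
  · rw [M.le_single h] at hwp hwq
    refine (M.le_cen _ _).2 fun i => ?_
    by_cases hi : i = j
    · subst hi
      have := sup_le hwp.1 hwq.1
      rwa [hq.sup_eq_top, top_le_iff] at this
    · exact hwp.2.2 i hi
  · rw [M.single_le h] at hwp hwq
    refine (M.cen_le _ _).2 fun i t ht => ?_
    by_cases hi : i = j
    · subst hi
      rw [BddFun.update_self] at ht
      have := le_inf (hwp.2 t ht) (hwq.2 t ht)
      rwa [hq.inf_eq_bot, le_bot_iff] at this
    · rw [BddFun.update_of_ne c hi] at ht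
      exact hwp.1 i t ht

theorem exists_eq_single [∀ j, IsModularLattice (L j)] {c : BddFun ι} {j : ι} {β : ℝ}
    (h : c.1 j < β) {x : X} (hx : M.IsRelCompl (M.cen c) (M.cen (c.update j β)) x) :
    ∃ p, x = M.single c j β p := by
  obtain ⟨hcx, hxb, y, hcy, hyb, hlow, hupp⟩ := hx
  have hsup : ∀ t, c.1 j ≤ t → M.E x j t ⊔ M.E y j t = ⊤ := by
    intro t ht
    obtain ⟨s, hts, hxs, hys⟩ := M.exists_right x y j t
    obtain ⟨N, -, hNs, hx, -, hy, -⟩ := M.exists_bound x y s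
    have hN : (BddFun.const ι (-N)).1 j < s := hNs
    have H := hlow (M.single (BddFun.const ι (-N)) j s (M.E x j t ⊔ M.E y j t))
      ((M.single_le hN _ _).2
        ⟨hx, fun r hr => (M.mono _ _ _ _ hr.le).trans (hxs.le.trans le_sup_left)⟩)
      ((M.single_le hN _ _).2
        ⟨hy, fun r hr => (M.mono _ _ _ _ hr.le).trans (hys.le.trans le_sup_right)⟩)
    have H' := (M.le_cen _ _).1 H j
    rw [M.E_single_self hN, if_pos (ht.trans_lt hts)] at H'
    split_ifs at H' with h1
    · exact top_le_iff.1 (H'.ge.trans bot_le)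
    · exact H'
  have hinf : ∀ t < β, M.E x j t ⊓ M.E y j t = ⊥ := by
    intro t ht
    obtain ⟨N, hN, -, -, hx, -, hy⟩ := M.exists_bound x y t
    set d := (BddFun.const ι N).update j t with hd
    have hdj : d.1 j = t := by simp [hd]
    have hdi : ∀ i, i ≠ j → d.1 i = N := fun i hi => by rw [hd, BddFun.update_of_ne _ hi]; rfl
    have hdN : d.1 j < N := by rwa [hdj]
    have H := hupp (M.single d j N (M.E x j t ⊓ M.E y j t))
      ((M.le_single hdN _ _).2 ⟨hdj.symm ▸ inf_le_left, hx j, fun i hi => hdi i hi ▸ hx i⟩)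
      ((M.le_single hdN _ _).2 ⟨hdj.symm ▸ inf_le_right, hy j, fun i hi => hdi i hi ▸ hy i⟩)
    have H' := (M.cen_le _ _).1 H j t (by simpa using ht)
    rwa [M.E_single_self hdN, hdj, if_neg (lt_irrefl t), if_pos hN] at H'
  -- `E x` and `E y` both increase and stay complementary, so by modularity `E x` is constant.
  have hconst : ∀ t, c.1 j ≤ t → t < β → M.E x j t = M.E x j (c.1 j) := by
    intro t hct htβ
    have hm := M.mono x j _ _ hct
    refine (eq_of_le_of_inf_le_of_sup_le hm (z := M.E y j (c.1 j)) ?_ ?_).symm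
    · exact ((inf_le_inf_left _ (M.mono y j _ _ hct)).trans (hinf t htβ).le).trans bot_le
    · exact le_top.trans (hsup _ le_rfl).ge
  refine ⟨M.E x j (c.1 j), M.injective _ _ fun i t => ?_⟩
  have hx0 := (M.cen_le _ _).1 hcx i t
  have hx1 := (M.le_cen _ _).1 hxb i
  by_cases hi : i = j
  · subst hi
    rw [M.E_single_self h]
    split_ifs with h1 h2
    · exact hx0 h1
    · exact hconst t (not_lt.1 h1) h2
    · rw [BddFun.update_self] at hx1
      exact top_le_iff.1 (hx1.ge.trans (M.mono _ _ _ _ (not_lt.1 h2)))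
  · rw [single, M.E_step (le_update h), BddFun.update_of_ne c hi]
    rw [BddFun.update_of_ne c hi] at hx1
    split_ifs with h1
    · exact hx0 h1
    · exact top_le_iff.1 (hx1.ge.trans (M.mono _ _ _ _ (not_lt.1 h1)))

/-! ### Order isomorphisms -/

variable {κ : Type*} {L' : κ → Type*} [∀ k, Lattice (L' k)] [∀ k, BoundedOrder (L' k)] {Y : Type*}
  {M} {M' : SpectralModel L' Y}

theorem cancel_map_iff (Φ : X ≃ Y) (hΦ : ∀ x y, M.le x y ↔ M'.le (Φ x) (Φ y)) (z : X) :
    M'.Cancel (Φ z) ↔ M.Cancel z := by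
  simp only [Cancel, Φ.surjective.forall, ← hΦ, Φ.injective.eq_iff]

theorem isRelCompl_map_iff (Φ : X ≃ Y) (hΦ : ∀ x y, M.le x y ↔ M'.le (Φ x) (Φ y)) (a b x : X) :
    M'.IsRelCompl (Φ a) (Φ b) (Φ x) ↔ M.IsRelCompl a b x := by
  simp only [IsRelCompl, Φ.surjective.forall, Φ.surjective.exists, ← hΦ]

theorem exists_orderIso_cen [∀ j, Nontrivial (L j)] [∀ k, Nontrivial (L' k)]
    (hL : ∀ j (p : L j), p ≠ ⊥ → p ≠ ⊤ → ∃ q r, q ≠ r ∧ IsCompl p q ∧ IsCompl p r)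
    (hL' : ∀ k (p : L' k), p ≠ ⊥ → p ≠ ⊤ → ∃ q r, q ≠ r ∧ IsCompl p q ∧ IsCompl p r)
    (Φ : X ≃ Y) (hΦ : ∀ x y, M.le x y ↔ M'.le (Φ x) (Φ y)) :
    ∃ ψ : BddFun ι ≃o BddFun κ, ∀ c, Φ (M.cen c) = M'.cen (ψ c) := by
  have h1 : ∀ c, ∃ d, Φ (M.cen c) = M'.cen d := fun c =>
    (M'.cancel_iff_exists_eq_cen hL' _).1
      ((cancel_map_iff Φ hΦ _).2 ((M.cancel_iff_exists_eq_cen hL _).2 ⟨c, rfl⟩))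
  have h2 : ∀ d, ∃ c, Φ.symm (M'.cen d) = M.cen c := fun d =>
    (M.cancel_iff_exists_eq_cen hL _).1
      ((cancel_map_iff Φ hΦ _).1 ((M'.cancel_iff_exists_eq_cen hL' _).2
        ⟨d, Φ.apply_symm_apply _⟩))
  choose u hu using h1
  choose v hv using h2
  refine ⟨⟨⟨u, v, fun c => M.cen_injective ?_, fun d => M'.cen_injective ?_⟩, ?_⟩, hu⟩
  · rw [← hv, ← hu, Φ.symm_apply_apply]
  · rw [← hu, ← hv, Φ.apply_symm_apply]
  · intro c d
    change u c ≤ u d ↔ c ≤ d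
    rw [← M'.cen_le_cen, ← hu, ← hu, ← hΦ, M.cen_le_cen]

/-- A spectral order isomorphism permutes the indices, and at each index it rescales the real line
and transports the spectral projections along an isomorphism of lattices. -/
theorem exists_forall_E_map [∀ j, Nontrivial (L j)] [∀ k, Nontrivial (L' k)]
    [∀ j, ComplementedLattice (L j)] [∀ k, ComplementedLattice (L' k)]
    [∀ j, IsModularLattice (L j)] [∀ k, IsModularLattice (L' k)]
    (hL : ∀ j (p : L j), p ≠ ⊥ → p ≠ ⊤ → ∃ q r, q ≠ r ∧ IsCompl p q ∧ IsCompl p r)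
    (hL' : ∀ k (p : L' k), p ≠ ⊥ → p ≠ ⊤ → ∃ q r, q ≠ r ∧ IsCompl p q ∧ IsCompl p r)
    (Φ : X ≃ Y) (hΦ : ∀ x y, M.le x y ↔ M'.le (Φ x) (Φ y)) :
    ∃ (σ : ι ≃ κ) (f : ι → ℝ ≃o ℝ) (T : ∀ j, L j ≃o L' (σ j)),
      ∀ x j t, M'.E (Φ x) (σ j) (f j t) = T j (M.E x j t) := by
  obtain ⟨ψ, hψ⟩ := exists_orderIso_cen hL hL' Φ hΦ
  obtain ⟨σ, f, hf⟩ := BddFun.exists_equiv_forall_apply ψ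
  have hψu : ∀ c j β, ψ (c.update j β) = (ψ c).update (σ j) (f j β) := by
    intro c j β
    refine Subtype.ext (funext fun k => ?_)
    obtain ⟨i, rfl⟩ := σ.surjective k
    rw [hf]
    by_cases hi : i = j
    · subst hi; simp
    · rw [BddFun.update_of_ne _ hi, BddFun.update_of_ne _ (σ.injective.ne hi), hf]
  have hlt : ∀ {c : BddFun ι} {j β}, c.1 j < β → (ψ c).1 (σ j) < f j β := by
    intro c j β h
    rw [hf]
    exact (f j).lt_iff_lt.2 h
  have hT : ∀ (c : BddFun ι) j β, c.1 j < β → ∃ T : L j ≃o L' (σ j),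
      ∀ p, Φ (M.single c j β p) = M'.single (ψ c) (σ j) (f j β) (T p) := by
    intro c j β h
    have h1 : ∀ p, ∃ q, Φ (M.single c j β p) = M'.single (ψ c) (σ j) (f j β) q := by
      refine fun p => M'.exists_eq_single (hlt h) ?_
      rw [← hψu, ← hψ, ← hψ, isRelCompl_map_iff Φ hΦ]
      exact M.isRelCompl_single h p
    choose T hT using h1
    have hle : ∀ p q, T p ≤ T q ↔ p ≤ q := fun p q => by
      rw [← M'.single_le_single le_rfl (hlt h) le_rfl, ← hT, ← hT, ← hΦ,
        M.single_le_single le_rfl h le_rfl]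
    refine ⟨RelIso.ofSurjective (OrderEmbedding.ofMapLEIff T hle) fun q => ?_, hT⟩
    have hq := M'.isRelCompl_single (hlt h) q
    rw [← hψu, ← hψ, ← hψ, ← Φ.apply_symm_apply (M'.single _ _ _ q),
      isRelCompl_map_iff Φ hΦ] at hq
    obtain ⟨p, hp⟩ := M.exists_eq_single h hq
    rw [Equiv.symm_apply_eq, hT] at hp
    refine ⟨p, le_antisymm ?_ ?_⟩
    · exact (M'.single_le_single le_rfl (hlt h) le_rfl _ _).1 fun _ _ => by rw [hp]; exact le_rfl
    · exact (M'.single_le_single le_rfl (hlt h) le_rfl _ _).1 fun _ _ => by rw [hp]; exact le_rfl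
  have indep : ∀ {c d : BddFun ι} {j β β'} {T T' : L j ≃o L' (σ j)}, c ≤ d → d.1 j < β → β ≤ β' →
      (∀ p, Φ (M.single c j β p) = M'.single (ψ c) (σ j) (f j β) (T p)) →
      (∀ p, Φ (M.single d j β' p) = M'.single (ψ d) (σ j) (f j β') (T' p)) → T = T' := by
    intro c d j β β' T T' hcd hd hβ hT hT'
    have key : ∀ p q, T' q ≤ T p ↔ q ≤ p := fun p q => by
      rw [← M'.single_le_single (ψ.monotone hcd) (hlt hd) ((f j).monotone hβ), ← hT, ← hT', ← hΦ,
        M.single_le_single hcd hd hβ]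
    ext p
    refine le_antisymm ?_ ((key p p).2 le_rfl)
    obtain ⟨q, hq⟩ := T'.surjective (T p)
    rw [← hq]
    exact T'.monotone ((key p q).1 hq.le)
  choose T hT0 using fun j => hT (BddFun.const ι 0) j 1 zero_lt_one
  have hT1 : ∀ (c : BddFun ι) j β, c.1 j < β →
      ∀ p, Φ (M.single c j β p) = M'.single (ψ c) (σ j) (f j β) (T j p) := by
    intro c j β h
    -- Both intervals are compared with a common larger one.
    set d := BddFun.const ι 0
    have hd : d.1 j < 1 := zero_lt_one
    obtain ⟨T₀, h₀⟩ := hT c j β h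
    obtain ⟨T₁, h₁⟩ := hT c j (max β 1) (h.trans_le (le_max_left _ _))
    obtain ⟨T₂, h₂⟩ := hT (c ⊓ d) j (max β 1)
      ((inf_le_left : c ⊓ d ≤ c) j |>.trans_lt (h.trans_le (le_max_left _ _)))
    obtain ⟨T₃, h₃⟩ := hT d j (max β 1) (hd.trans_le (le_max_right _ _))
    have e₁ : T₀ = T₁ := indep le_rfl h (le_max_left _ _) h₀ h₁
    have e₂ : T₂ = T₁ := indep inf_le_left (h.trans_le (le_max_left _ _)) le_rfl h₂ h₁
    have e₃ : T₂ = T₃ := indep inf_le_right (hd.trans_le (le_max_right _ _)) le_rfl h₂ h₃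
    have e₄ : T j = T₃ := indep le_rfl hd (le_max_right _ _) (hT0 j) h₃
    rwa [e₄, ← e₃, e₂, ← e₁]
  refine ⟨σ, f, T, fun x j t => ?_⟩
  have key : ∀ p, p ≤ M.E x j t ↔ T j p ≤ M'.E (Φ x) (σ j) (f j t) := by
    intro p
    obtain ⟨N, hN, -, -, hx, -⟩ := M.exists_bound x x t
    set c := (BddFun.const ι N).update j t with hc
    have hcj : c.1 j = t := by simp [hc]
    have hci : ∀ i, i ≠ j → c.1 i = N := fun i hi => by rw [hc, BddFun.update_of_ne _ hi]; rfl
    have hcN : c.1 j < N := by rwa [hcj]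
    have hxN : M'.le (Φ x) (M'.cen (ψ (BddFun.const ι N))) := by
      rw [← hψ, ← hΦ]
      exact (M.le_cen _ _).2 hx
    have hN' : ∀ i, M'.E (Φ x) (σ i) (f i N) = ⊤ := fun i => by
      have := (M'.le_cen _ _).1 hxN (σ i)
      rwa [hf] at this
    have e1 : M.le x (M.single c j N p) ↔ p ≤ M.E x j t := by
      rw [M.le_single hcN, hcj]
      exact ⟨fun h => h.1, fun h => ⟨h, hx j, fun i hi => hci i hi ▸ hx i⟩⟩
    rw [← e1, hΦ, hT1 c j N hcN, M'.le_single (hlt hcN), hf, hcj]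
    refine ⟨fun h => h.1, fun h => ⟨h, hN' j, fun k hk => ?_⟩⟩
    obtain ⟨i, rfl⟩ := σ.surjective k
    rw [hf, hci i fun hi => hk (by rw [hi])]
    exact hN' i
  obtain ⟨q, hq⟩ := (T j).surjective (M'.E (Φ x) (σ j) (f j t))
  rw [← hq]
  exact congrArg _ (le_antisymm ((key q).2 hq.le) ((T j).le_iff_le.1 (hq ▸ (key _).1 le_rfl)))

end SpectralModel

/-! ### Projections and subspaces -/

section Projections

variable {n : ℕ}

theorem Proj.le_iff {A : Type*} [Ring A] [StarRing A] {p q : Proj A} :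
    p ≤ q ↔ p.val * q.val = p.val := Iff.rfl

theorem Proj.le_iff' {A : Type*} [Ring A] [StarRing A] {p q : Proj A} :
    p ≤ q ↔ q.val * p.val = p.val := by
  rw [Proj.le_iff]
  constructor <;> intro h
  · simpa [p.isProj.isSelfAdjoint.star_eq, q.isProj.isSelfAdjoint.star_eq] using congrArg star h
  · simpa [p.isProj.isSelfAdjoint.star_eq, q.isProj.isSelfAdjoint.star_eq] using congrArg star h

theorem Proj.val_mul_self {A : Type*} [Ring A] [StarRing A] (p : Proj A) :
    p.val * p.val = p.val := p.isProj.isIdempotentElem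

/-- The projection lattice of `B(ℂⁿ)` is the lattice of subspaces of `ℂⁿ`. -/
def projEquiv (n : ℕ) : Proj (MatAlg n) ≃o Submodule ℂ (EuclideanSpace ℂ (Fin n)) where
  toFun p := p.val.range
  invFun U := ⟨U.starProjection, isStarProjection_starProjection⟩
  left_inv p := by
    refine Proj.ext ?_
    obtain ⟨_, h⟩ := isStarProjection_iff_eq_starProjection_range.1 p.isProj
    exact h.symm
  right_inv U := Submodule.range_starProjection U
  map_rel_iff' := by
    intro p q
    rw [Proj.le_iff']
    constructor
    · intro h
      ext1 v
      obtain ⟨w, hw⟩ := h (show p.val v ∈ p.val.range from ⟨v, rfl⟩)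
      have hw' : q.val w = p.val v := hw
      rw [mul_apply_eq_comp, ← hw', ← mul_apply_eq_comp, q.val_mul_self]
    · rintro h _ ⟨v, rfl⟩
      exact ⟨p.val v, congrArg (fun a : MatAlg n => a v) h⟩

theorem projEquiv_of_val_eq_zero {p : Proj (MatAlg n)} (h : p.val = 0) : projEquiv n p = ⊥ := by
  change p.val.range = ⊥
  rw [h]
  simp

theorem projEquiv_of_val_eq_one {p : Proj (MatAlg n)} (h : p.val = 1) : projEquiv n p = ⊤ := by
  change p.val.range = ⊤
  rw [h]
  exact LinearMap.range_id

theorem mem_projEquiv_iff {p : Proj (MatAlg n)} {v : EuclideanSpace ℂ (Fin n)} :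
    v ∈ projEquiv n p ↔ p.val v = v := by
  constructor
  · rintro ⟨w, rfl⟩
    exact congrArg (fun a : MatAlg n => a w) p.val_mul_self
  · exact fun h => ⟨v, h⟩

/-- A proper nonzero subspace `p` has two distinct complements: for a vector `v` outside and a
nonzero vector `u` inside `p`, one containing `v` and one containing `v + u`. -/
theorem Submodule.exists_two_isCompl {K V : Type*} [DivisionRing K] [AddCommGroup V] [Module K V]
    (p : Submodule K V) (h0 : p ≠ ⊥) (h1 : p ≠ ⊤) :
    ∃ q r, q ≠ r ∧ IsCompl p q ∧ IsCompl p r := by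
  obtain ⟨u, hu, hu0⟩ := p.exists_mem_ne_zero_of_ne_bot h0
  obtain ⟨v, hv⟩ : ∃ v, v ∉ p := by
    by_contra! h
    exact h1 (eq_top_iff.2 fun v _ => h v)
  have key : ∀ w, w ∉ p → ∃ q, w ∈ q ∧ IsCompl p q := by
    intro w hw
    have hd : Disjoint (K ∙ w) p := Submodule.disjoint_span_singleton_of_notMem hw |>.symm
    obtain ⟨q, hq, hc⟩ := hd.exists_isCompl
    exact ⟨q, hq (Submodule.mem_span_singleton_self w), hc.symm⟩
  obtain ⟨q, hvq, hq⟩ := key v hv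
  obtain ⟨r, hvr, hr⟩ := key (v + u) fun h => hv ((p.add_mem_iff_left hu).1 h)
  refine ⟨q, r, ?_, hq, hr⟩
  rintro rfl
  exact hu0 (Submodule.disjoint_def.1 hq.disjoint u hu ((q.add_mem_iff_right hvq).1 hvr))

theorem eq_of_submodule_orderIso {a b : ℕ}
    (e : Submodule ℂ (EuclideanSpace ℂ (Fin a)) ≃o Submodule ℂ (EuclideanSpace ℂ (Fin b))) :
    a = b := by
  have h : Module.length ℂ (EuclideanSpace ℂ (Fin a)) =
      Module.length ℂ (EuclideanSpace ℂ (Fin b)) := by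
    rw [Module.length_eq_height, Module.length_eq_height, ← e.map_top, Order.height_orderIso]
  rw [Module.length_eq_finrank, Module.length_eq_finrank] at h
  simpa using h

end Projections

/-! ### Spectral families of self-adjoint matrices -/

section Spectral

variable {n : ℕ}

theorem finite_real_spectrum (x : MatAlg n) : (spectrum ℝ x).Finite := by
  have h : (spectrum ℂ x).Finite := by
    rw [← AlgEquiv.spectrum_eq
      (Module.End.toContinuousLinearMap (𝕜 := ℂ) (E := EuclideanSpace ℂ (Fin n))).symm x]
    exact Module.End.finite_spectrum _
  rw [← spectrum.preimage_algebraMap (R := ℝ) ℂ]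
  exact h.preimage (FaithfulSMul.algebraMap_injective ℝ ℂ).injOn

theorem continuousOn_spectrum (x : MatAlg n) (g : ℝ → ℝ) : ContinuousOn g (spectrum ℝ x) :=
  (finite_real_spectrum x).continuousOn g

/-- The functional calculus is defined for every function since spectra are finite. -/
theorem cfc_apply_of_eigenvector {x : MatAlg n} (hx : IsSelfAdjoint x) (g : ℝ → ℝ) {c : ℝ}
    {v : EuclideanSpace ℂ (Fin n)} (hv : x v = (c : ℂ) • v) : cfc g x v = (g c : ℂ) • v := by
  have hcont := continuousOn_spectrum x
  -- Divide `g - g c` by the identity minus `c`; the value of the quotient at `c` is irrelevant.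
  have h : cfc (fun s => (g s - g c) / (s - c)) x * (x - algebraMap ℝ _ c) =
      cfc g x - algebraMap ℝ _ (g c) := by
    have e1 : x - algebraMap ℝ _ c = cfc (fun s : ℝ => s - c) x := by
      rw [cfc_sub _ _ x (hcont _) (hcont _), cfc_id' ℝ x, cfc_const c x]
    have e2 : cfc g x - algebraMap ℝ _ (g c) = cfc (fun s : ℝ => g s - g c) x := by
      rw [cfc_sub _ _ x (hcont _) (hcont _), cfc_const (g c) x]
    rw [e1, e2, ← cfc_mul _ _ x (hcont _) (hcont _)]
    refine cfc_congr fun s _ => ?_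
    by_cases hs : s = c
    · simp [hs]
    · exact div_mul_cancel₀ _ (sub_ne_zero.2 hs)
  have h' := congrArg (fun a : MatAlg n => a v) h
  have e : ∀ r : ℝ, (algebraMap ℝ (MatAlg n) r) v = (r : ℂ) • v := fun r => by
    rw [Algebra.algebraMap_eq_smul_one]
    rfl
  simp only [mul_apply_eq_comp, sub_apply, e, hv, sub_self,
    map_zero] at h'
  exact (sub_eq_zero.1 h'.symm)

/-- Operators are equal if they agree on the eigenvectors of a self-adjoint operator. -/
theorem ext_of_eigenvectors {x : MatAlg n} (hx : IsSelfAdjoint x) {a b : MatAlg n}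
    (h : ∀ (c : ℝ) v, x v = (c : ℂ) • v → a v = b v) : a = b := by
  have hs : x.toLinearMap.IsSymmetric := ContinuousLinearMap.isSelfAdjoint_iff_isSymmetric.1 hx
  have hn : Module.finrank ℂ (EuclideanSpace ℂ (Fin n)) = n := by simp
  apply ContinuousLinearMap.coe_injective
  refine (hs.eigenvectorBasis hn).toBasis.ext fun i => ?_
  rw [OrthonormalBasis.coe_toBasis]
  exact h _ _ (hs.apply_eigenvectorBasis hn i)

theorem StdLE.exists_norm_sq {a b : MatAlg n} (h : StdLE a b) : ∃ s : MatAlg n,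
    b - a = star s * s ∧
      ∀ v, inner ℂ v ((b - a) v) = ((‖s v‖ ^ 2 : ℝ) : ℂ) := by
  obtain ⟨s, hs⟩ := h
  refine ⟨s, hs, fun v => ?_⟩
  rw [hs, mul_apply_eq_comp, ContinuousLinearMap.star_eq_adjoint,
    ContinuousLinearMap.adjoint_inner_right, inner_self_eq_norm_sq_to_K]
  push_cast
  rfl

theorem StdLE.eq_zero_of_neg {a b : MatAlg n} (h : StdLE a b) {c : ℝ} (hc : c < 0)
    {v : EuclideanSpace ℂ (Fin n)} (hv : (b - a) v = (c : ℂ) • v) : v = 0 := by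
  obtain ⟨s, -, hs⟩ := h.exists_norm_sq
  have h1 := hs v
  rw [hv, inner_smul_right, inner_self_eq_norm_sq_to_K] at h1
  have h2 : c * ‖v‖ ^ 2 = ‖s v‖ ^ 2 := by
    apply Complex.ofReal_injective
    rw [← h1]
    push_cast
    rfl
  by_contra hv0
  nlinarith [sq_nonneg ‖s v‖, sq_pos_of_pos (norm_pos_iff.2 hv0)]

theorem IsSpectralFamilyOf.commute {x : MatAlg n} (hx : IsSelfAdjoint x)
    {E : ℝ → Proj (MatAlg n)} (hE : IsSpectralFamilyOf x E) (t : ℝ) : Commute x (E t).val := by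
  obtain ⟨s, hs⟩ := hE.mul_le t
  have hE' := (E t).isProj.isSelfAdjoint
  have ht : IsSelfAdjoint (t : ℂ) := Complex.conj_ofReal t
  have h : IsSelfAdjoint (x * (E t).val) := by
    rw [← sub_sub_cancel ((t : ℂ) • (E t).val) (x * (E t).val), hs]
    exact (ht.smul hE').sub (.star_mul_self s)
  exact (hx.commute_iff hE').2 h

theorem IsSpectralFamilyOf.apply_of_lt {x : MatAlg n} (hx : IsSelfAdjoint x)
    {E : ℝ → Proj (MatAlg n)} (hE : IsSpectralFamilyOf x E) {t c : ℝ} (h : t < c)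
    {v : EuclideanSpace ℂ (Fin n)} (hv : x v = (c : ℂ) • v) : (E t).val v = 0 := by
  have hEE : (E t).val ((E t).val v) = (E t).val v :=
    congrArg (fun a : MatAlg n => a v) (E t).val_mul_self
  have hxE : x ((E t).val v) = (c : ℂ) • (E t).val v := by
    rw [← map_smul, ← hv]
    exact congrArg (fun a : MatAlg n => a v) (hE.commute hx t)
  refine (hE.mul_le t).eq_zero_of_neg (sub_neg.2 h) ?_
  simp only [sub_apply, smul_apply,
    mul_apply_eq_comp, hEE, hxE]
  push_cast
  rw [sub_smul]

theorem IsSpectralFamilyOf.apply_of_gt {x : MatAlg n} (hx : IsSelfAdjoint x)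
    {E : ℝ → Proj (MatAlg n)} (hE : IsSpectralFamilyOf x E) {t c : ℝ} (h : c < t)
    {v : EuclideanSpace ℂ (Fin n)} (hv : x v = (c : ℂ) • v) : (E t).val v = v := by
  have hEE : (E t).val ((E t).val v) = (E t).val v :=
    congrArg (fun a : MatAlg n => a v) (E t).val_mul_self
  have hxE : x ((E t).val v) = (c : ℂ) • (E t).val v := by
    rw [← map_smul, ← hv]
    exact congrArg (fun a : MatAlg n => a v) (hE.commute hx t)
  refine (sub_eq_zero.1 ((hE.le_mul t).eq_zero_of_neg (sub_neg.2 h) ?_)).symm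
  simp only [sub_apply, smul_apply,
    mul_apply_eq_comp, one_apply_eq_self, map_sub, hEE, hxE, hv]
  push_cast
  module

/-- A spectral family of `x` is determined on the eigenvectors of `x`. -/
theorem IsSpectralFamilyOf.apply_eigenvector {x : MatAlg n} (hx : IsSelfAdjoint x)
    {E : ℝ → Proj (MatAlg n)} (hE : IsSpectralFamilyOf x E) (t : ℝ) {c : ℝ}
    {v : EuclideanSpace ℂ (Fin n)} (hv : x v = (c : ℂ) • v) :
    (E t).val v = if c ≤ t then v else 0 := by
  split_ifs with h
  · -- The projection onto the line through `v` is below `E s` for `s > t`, hence below `E t`.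
    have hlow : (projEquiv n).symm (ℂ ∙ v) ≤ E t := by
      refine (hE.isSpectralFamily.isGLB t).2 ?_
      rintro _ ⟨s, hs, rfl⟩
      rw [OrderIso.symm_apply_le, Submodule.span_singleton_le_iff_mem, mem_projEquiv_iff]
      exact hE.apply_of_gt hx (h.trans_lt hs) hv
    rwa [OrderIso.symm_apply_le, Submodule.span_singleton_le_iff_mem, mem_projEquiv_iff] at hlow
  · exact hE.apply_of_lt hx (not_le.1 h) hv

/-- The spectral projection of `x` for the half-line up to `t`. -/
def specProj (x : MatAlg n) (t : ℝ) : Proj (MatAlg n) where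
  val := cfc (fun s : ℝ => if s ≤ t then 1 else 0) x
  isProj :=
    { isIdempotentElem := by
        rw [IsIdempotentElem,
          ← cfc_mul _ _ x (continuousOn_spectrum x _) (continuousOn_spectrum x _)]
        exact cfc_congr fun s _ => by split_ifs <;> simp
      isSelfAdjoint := cfc_predicate _ x }

theorem specProj_apply_eigenvector {x : MatAlg n} (hx : IsSelfAdjoint x) (t : ℝ) {c : ℝ}
    {v : EuclideanSpace ℂ (Fin n)} (hv : x v = (c : ℂ) • v) :
    (specProj x t).val v = if c ≤ t then v else 0 := by
  change cfc _ x v = _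
  rw [cfc_apply_of_eigenvector hx _ hv]
  split_ifs <;> simp

theorem IsSpectralFamilyOf.eq_specProj {x : MatAlg n} (hx : IsSelfAdjoint x)
    {E : ℝ → Proj (MatAlg n)} (hE : IsSpectralFamilyOf x E) : E = specProj x := by
  funext t
  refine Proj.ext (ext_of_eigenvectors hx fun c v hv => ?_)
  rw [hE.apply_eigenvector hx t hv, specProj_apply_eigenvector hx t hv]

theorem specProj_mono (x : MatAlg n) {s t : ℝ} (h : s ≤ t) : specProj x s ≤ specProj x t := by
  rw [Proj.le_iff]
  change cfc _ x * cfc _ x = cfc _ x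
  rw [← cfc_mul _ _ x (continuousOn_spectrum x _) (continuousOn_spectrum x _)]
  refine cfc_congr fun r _ => ?_
  by_cases hr : r ≤ s
  · simp [hr, hr.trans h]
  · simp [hr]

theorem exists_specProj_eq (x : MatAlg n) (t : ℝ) : ∃ s, t < s ∧ specProj x s = specProj x t := by
  obtain ⟨s, hts, hs⟩ : ∃ s, t < s ∧ ∀ r ∈ spectrum ℝ x, r ≤ s → r ≤ t := by
    have h : ∀ᶠ s in nhdsWithin t (Set.Ioi t), ∀ r ∈ spectrum ℝ x, r ≤ s → r ≤ t := by
      rw [(finite_real_spectrum x).eventually_all]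
      intro r _
      by_cases hr : r ≤ t
      · exact Filter.Eventually.of_forall fun _ _ => hr
      · filter_upwards [Ioo_mem_nhdsGT (not_le.1 hr)] with s hs h'
        exact absurd h' hs.2.not_ge
    obtain ⟨s, h1, h2⟩ := (h.and self_mem_nhdsWithin).exists
    exact ⟨s, h2, h1⟩
  refine ⟨s, hts, Proj.ext (cfc_congr fun r hr => ?_)⟩
  have : r ≤ s ↔ r ≤ t := ⟨hs r hr, fun h => h.trans hts.le⟩
  simp [this]

theorem norm_le_of_mem_real_spectrum {x : MatAlg n} {r : ℝ} (hr : r ∈ spectrum ℝ x) :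
    |r| ≤ ‖x‖ := by
  cases subsingleton_or_nontrivial (MatAlg n) with
  | inl h => simp [spectrum.of_subsingleton] at hr
  | inr h => simpa using spectrum.norm_le_norm_of_mem hr

theorem specProj_of_lt {x : MatAlg n} {t : ℝ} (h : t < -‖x‖) :
    (specProj x t).val = 0 := by
  change cfc _ x = 0
  rw [← cfc_const_zero ℝ x]
  refine cfc_congr fun r hr => if_neg fun hrt => ?_
  linarith [neg_abs_le r, norm_le_of_mem_real_spectrum hr]

theorem specProj_of_ge {x : MatAlg n} (hx : IsSelfAdjoint x) {t : ℝ} (h : ‖x‖ ≤ t) :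
    (specProj x t).val = 1 := by
  change cfc _ x = 1
  rw [← cfc_const_one ℝ x]
  exact cfc_congr fun r hr =>
    if_pos ((le_abs_self r).trans ((norm_le_of_mem_real_spectrum hr).trans h))

theorem stdLE_cfc {x : MatAlg n} (g k : ℝ → ℝ) (h : ∀ s, g s ≤ k s) :
    StdLE (cfc g x) (cfc k x) := by
  have hcont := continuousOn_spectrum x
  refine ⟨cfc (fun s => √(k s - g s)) x, ?_⟩
  have hsa : IsSelfAdjoint (cfc (fun s => √(k s - g s)) x) := cfc_predicate _ x
  rw [hsa.star_eq, ← cfc_mul _ _ x (hcont _) (hcont _), ← cfc_sub _ _ x (hcont _) (hcont _)]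
  exact cfc_congr fun s _ => (Real.mul_self_sqrt (sub_nonneg.2 (h s))).symm

theorem isSpectralFamilyOf_specProj {x : MatAlg n} (hx : IsSelfAdjoint x) :
    IsSpectralFamilyOf x (specProj x) := by
  have hcont := continuousOn_spectrum x
  have hsm : ∀ (t : ℝ) (a : MatAlg n), (t : ℂ) • a = t • a := fun t a => rfl
  refine ⟨⟨fun s t h => specProj_mono x h, fun t => ⟨?_, fun q hq => ?_⟩, ?_⟩,
    fun t => ?_, fun t => ?_⟩
  · rintro _ ⟨s, hs, rfl⟩
    exact specProj_mono x (le_of_lt hs)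
  · obtain ⟨s, hs, h⟩ := exists_specProj_eq x t
    exact h ▸ hq ⟨s, hs, rfl⟩
  · refine ⟨‖x‖ + 1, by positivity, fun t ht => specProj_of_lt (by linarith),
      fun t ht => specProj_of_ge hx (by linarith)⟩
  · have e1 : x * (specProj x t).val = cfc (fun s : ℝ => s * if s ≤ t then 1 else 0) x := by
      rw [cfc_mul _ _ x (hcont _) (hcont _), cfc_id' ℝ x]
      rfl
    have e2 : (t : ℂ) • (specProj x t).val = cfc (fun s : ℝ => t * if s ≤ t then 1 else 0) x := by
      rw [cfc_const_mul _ _ x (hcont _)]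
      rfl
    rw [e1, e2]
    refine stdLE_cfc _ _ fun s => ?_
    split_ifs with h
    · simpa using h
    · simp
  · have e0 : 1 - (specProj x t).val = cfc (fun s : ℝ => 1 - if s ≤ t then 1 else 0) x := by
      rw [cfc_sub _ _ x (hcont _) (hcont _), cfc_const_one ℝ x]
      rfl
    have e1 : x * (1 - (specProj x t).val) =
        cfc (fun s : ℝ => s * (1 - if s ≤ t then 1 else 0)) x := by
      rw [cfc_mul _ _ x (hcont _) (hcont _), cfc_id' ℝ x, e0]
    have e2 : (t : ℂ) • (1 - (specProj x t).val) =
        cfc (fun s : ℝ => t * (1 - if s ≤ t then 1 else 0)) x := by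
      rw [cfc_const_mul _ _ x (hcont _), e0]
      rfl
    rw [e1, e2]
    refine stdLE_cfc _ _ fun s => ?_
    split_ifs with h
    · simp
    · simpa using (not_le.1 h).le

/-- A self-adjoint operator is determined by its spectral projections: on an eigenvector of `x` for
`c`, the spectral family of `y` forces the quadratic form of `c - y` to vanish. -/
theorem eq_of_specProj_eq {x y : MatAlg n} (hx : IsSelfAdjoint x) (hy : IsSelfAdjoint y)
    (h : ∀ t, specProj x t = specProj y t) : x = y := by
  refine ext_of_eigenvectors hx fun c v hv => ?_
  have hF := isSpectralFamilyOf_specProj hy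
  have hval : ∀ t, (specProj y t).val v = if c ≤ t then v else 0 := fun t => by
    rw [← h, specProj_apply_eigenvector hx t hv]
  obtain ⟨s, hs, hsv⟩ := (hF.mul_le c).exists_norm_sq
  have hc : ((c : ℂ) • (specProj y c).val - y * (specProj y c).val) v = (c : ℂ) • v - y v := by
    simp [hval]
  set q : ℝ := (inner ℂ v (y v)).re with hq
  have hre : ∀ t : ℝ, (inner ℂ v ((t : ℂ) • v)).re = t * ‖v‖ ^ 2 := fun t => by
    rw [inner_smul_right, inner_self_eq_norm_sq_to_K, Complex.re_ofReal_mul]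
    norm_cast
  have h1 : c * ‖v‖ ^ 2 - q = ‖s v‖ ^ 2 := by
    have := congrArg Complex.re (hsv v)
    rwa [hc, inner_sub_right, Complex.sub_re, hre, Complex.ofReal_re] at this
  have h2 : ∀ t < c, t * ‖v‖ ^ 2 ≤ q := by
    intro t ht
    obtain ⟨r, -, hr⟩ := (hF.le_mul t).exists_norm_sq
    have := congrArg Complex.re (hr v)
    have hd : (y * (1 - (specProj y t).val) - (t : ℂ) • (1 - (specProj y t).val)) v =
        y v - (t : ℂ) • v := by
      simp [hval, ht.not_ge]
    rw [hd, inner_sub_right, Complex.sub_re, hre, Complex.ofReal_re] at this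
    nlinarith [sq_nonneg ‖r v‖]
  have h3 : c * ‖v‖ ^ 2 ≤ q := by
    have hcont : Filter.Tendsto (fun t : ℝ => t * ‖v‖ ^ 2) (nhdsWithin c (Set.Iio c))
        (nhds (c * ‖v‖ ^ 2)) :=
      (Continuous.tendsto (by fun_prop) c).mono_left nhdsWithin_le_nhds
    exact le_of_tendsto hcont (Filter.eventually_of_mem self_mem_nhdsWithin h2)
  have h4 : s v = 0 := by
    rw [← norm_eq_zero]
    nlinarith [sq_nonneg ‖s v‖]
  have h5 : (c : ℂ) • v - y v = 0 := by
    rw [← hc, hs, mul_apply_eq_comp, h4, map_zero]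
  rw [hv]
  exact sub_eq_zero.1 h5

theorem specProj_cfc {x : MatAlg n} (hx : IsSelfAdjoint x) (f : ℝ ≃o ℝ) (t : ℝ) :
    specProj (cfc f x) (f t) = specProj x t := by
  refine Proj.ext ?_
  change cfc _ (cfc f x) = cfc _ x
  rw [← cfc_comp _ f x hx ((((finite_real_spectrum x).image f)).continuousOn _)
    (continuousOn_spectrum x _)]
  exact cfc_congr fun s _ => by simp

/-- The spectral projections of the operator with eigenvalue `a` on `p` and `b` on `pᗮ`. -/
theorem projEquiv_specProj_step {a b : ℝ} (hab : a ≤ b)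
    (p : Submodule ℂ (EuclideanSpace ℂ (Fin n))) (t : ℝ) :
    projEquiv n (specProj ((a : ℂ) • p.starProjection + (b : ℂ) • (1 - p.starProjection)) t) =
      if t < a then ⊥ else if t < b then p else ⊤ := by
  set P : MatAlg n := p.starProjection with hP
  have hproj : IsStarProjection P := isStarProjection_starProjection
  have hPP : ∀ v, P (P v) = P v := fun v =>
    congrArg (fun a : MatAlg n => a v) hproj.isIdempotentElem
  set x : MatAlg n := (a : ℂ) • P + (b : ℂ) • (1 - P) with hx
  have hsa : IsSelfAdjoint x := by
    have hr : ∀ r : ℝ, IsSelfAdjoint (r : ℂ) := Complex.conj_ofReal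
    exact ((hr a).smul hproj.isSelfAdjoint).add ((hr b).smul hproj.one_sub.isSelfAdjoint)
  have hval : ∀ v, (specProj x t).val v =
      (if a ≤ t then P v else 0) + if b ≤ t then v - P v else 0 := by
    intro v
    have h1 : x (P v) = (a : ℂ) • P v := by simp [hx, hPP]
    have h2 : x (v - P v) = (b : ℂ) • (v - P v) := by simp [hx, hPP]
    rw [← specProj_apply_eigenvector hsa t h1, ← specProj_apply_eigenvector hsa t h2, ← map_add]
    simp
  split_ifs with h1 h2
  · apply projEquiv_of_val_eq_zero
    ext1 v
    rw [hval, if_neg h1.not_ge, if_neg (h1.trans_le hab).not_ge]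
    simp
  · have : (specProj x t).val = P := by
      ext1 v
      rw [hval, if_pos (not_lt.1 h1), if_neg h2.not_ge, add_zero]
    change (specProj x t).val.range = p
    rw [this]
    exact Submodule.range_starProjection p
  · apply projEquiv_of_val_eq_one
    ext1 v
    rw [hval, if_pos (not_lt.1 h1), if_pos (not_lt.1 h2)]
    simp

end Spectral

/-! ### Direct sums of matrix algebras -/

namespace MatSum

variable {ι : Type*} {m : ι → ℕ}

theorem norm_apply_le (x : MatSum m) : ∃ C, 0 ≤ C ∧ ∀ j, ‖x j‖ ≤ C := by
  obtain ⟨C, hC⟩ := memℓp_infty_iff.1 x.2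
  exact ⟨max C 0, le_max_right _ _, fun j => (hC ⟨j, rfl⟩).trans (le_max_left _ _)⟩

/-- The element of the direct sum with given uniformly bounded components. -/
def ofBounded (x : ∀ j, MatAlg (m j)) (C : ℝ) (h : ∀ j, ‖x j‖ ≤ C) : MatSum m :=
  ⟨x, memℓp_infty ⟨C, by rintro _ ⟨j, rfl⟩; exact h j⟩⟩

theorem ext {x y : MatSum m} (h : ∀ j, x j = y j) : x = y := Subtype.ext (funext h)

variable [∀ j, NeZero (m j)]

theorem sub_apply (x y : MatSum m) (j : ι) : (x - y) j = x j - y j := rfl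

theorem stdLE_iff {x y : MatSum m} : StdLE x y ↔ ∀ j, StdLE (x j) (y j) := by
  constructor
  · rintro ⟨s, hs⟩ j
    exact ⟨s j, congrArg (fun z : MatSum m => z j) hs⟩
  · intro h
    choose s hs using h
    obtain ⟨C, hC0, hC⟩ := norm_apply_le (y - x)
    -- The components are bounded by the C*-identity.
    refine ⟨ofBounded s (√C) fun j => Real.le_sqrt_of_sq_le ?_, ext hs⟩
    rw [pow_two, ← CStarRing.norm_star_mul_self, ← hs]
    exact hC j

/-- The projections of a direct sum are the families of projections of the summands. -/
def projPiEquiv (m : ι → ℕ) [∀ j, NeZero (m j)] :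
    Proj (MatSum m) ≃o ∀ j, Proj (MatAlg (m j)) where
  toFun p j := ⟨p.val j, congrArg (fun z : MatSum m => z j) p.isProj.isIdempotentElem,
    congrArg (fun z : MatSum m => z j) p.isProj.isSelfAdjoint⟩
  invFun q := ⟨ofBounded (fun j => (q j).val) 1 fun j => (q j).isProj.norm_le,
    ext fun j => (q j).isProj.isIdempotentElem, ext fun j => (q j).isProj.isSelfAdjoint⟩
  left_inv _ := rfl
  right_inv _ := rfl
  map_rel_iff' := by
    intro p q
    exact ⟨fun h => ext h, fun h j => congrArg (fun z : MatSum m => z j) h⟩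

theorem isGLB_iff (t : ℝ) (E : ℝ → Proj (MatSum m)) :
    IsGLB (E '' Set.Ioi t) (E t) ↔
      ∀ j, IsGLB ((fun s => projPiEquiv m (E s) j) '' Set.Ioi t) (projPiEquiv m (E t) j) := by
  rw [← (projPiEquiv m).isGLB_image', isGLB_pi]
  simp only [Set.image_image]

theorem isSelfAdjoint_apply {x : MatSum m} (hx : IsSelfAdjoint x) (j : ι) :
    IsSelfAdjoint (x j) := congrArg (fun z : MatSum m => z j) hx

theorem IsSpectralFamilyOf.apply {x : MatSum m} {E : ℝ → Proj (MatSum m)}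
    (h : IsSpectralFamilyOf x E) (j : ι) :
    IsSpectralFamilyOf (x j) fun t => projPiEquiv m (E t) j := by
  obtain ⟨α, hα, h0, h1⟩ := h.isSpectralFamily.bounded
  exact ⟨⟨fun s t hst => (projPiEquiv m).monotone (h.isSpectralFamily.mono s t hst) j,
    fun t => (isGLB_iff t E).1 (h.isSpectralFamily.isGLB t) j,
    α, hα, fun t ht => congrArg (fun z : MatSum m => z j) (h0 t ht),
    fun t ht => congrArg (fun z : MatSum m => z j) (h1 t ht)⟩,
    fun t => stdLE_iff.1 (h.mul_le t) j, fun t => stdLE_iff.1 (h.le_mul t) j⟩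

/-- The spectral family of a self-adjoint element of a direct sum. -/
def spec (x : MatSum m) (t : ℝ) : Proj (MatSum m) :=
  (projPiEquiv m).symm fun j => specProj (x j) t

theorem isSpectralFamilyOf_spec {x : MatSum m} (hx : IsSelfAdjoint x) :
    IsSpectralFamilyOf x (spec x) := by
  have h := fun j => isSpectralFamilyOf_specProj (isSelfAdjoint_apply hx j)
  obtain ⟨C, hC0, hC⟩ := norm_apply_le x
  exact ⟨⟨fun s t hst => (projPiEquiv m).symm.monotone fun j => specProj_mono (x j) hst,
    fun t => (isGLB_iff t _).2 fun j => (h j).isSpectralFamily.isGLB t,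
    C + 1, by positivity,
    fun t ht => ext fun j => specProj_of_lt (by linarith [hC j]),
    fun t ht => ext fun j => specProj_of_ge (isSelfAdjoint_apply hx j) (by linarith [hC j])⟩,
    fun t => stdLE_iff.2 fun j => (h j).mul_le t, fun t => stdLE_iff.2 fun j => (h j).le_mul t⟩

theorem IsSpectralFamilyOf.apply_eq {x : MatSum m} (hx : IsSelfAdjoint x)
    {E : ℝ → Proj (MatSum m)} (h : IsSpectralFamilyOf x E) (j : ι) (t : ℝ) :
    projPiEquiv m (E t) j = specProj (x j) t :=
  congrFun ((IsSpectralFamilyOf.apply h j).eq_specProj (isSelfAdjoint_apply hx j)) t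

theorem spectralLE_iff (x y : selfAdjoint (MatSum m)) :
    SpectralLE x y ↔
      ∀ j t, specProj ((y : MatSum m) j) t ≤ specProj ((x : MatSum m) j) t := by
  constructor
  · rintro ⟨E, F, hE, hF, h⟩ j t
    rw [← IsSpectralFamilyOf.apply_eq x.2 hE, ← IsSpectralFamilyOf.apply_eq y.2 hF]
    exact (projPiEquiv m).monotone (h t) j
  · exact fun h => ⟨_, _, isSpectralFamilyOf_spec x.2, isSpectralFamilyOf_spec y.2,
      fun t => (projPiEquiv m).symm.monotone fun j => h j t⟩

/-- The self-adjoint part of a direct sum of matrix algebras as a `SpectralModel` over the lattices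
of subspaces. -/
def spectralModel (m : ι → ℕ) [∀ j, NeZero (m j)] :
    SpectralModel (fun j => Submodule ℂ (EuclideanSpace ℂ (Fin (m j))))
      (selfAdjoint (MatSum m)) where
  E x j t := projEquiv (m j) (specProj ((x : MatSum m) j) t)
  injective x y h := Subtype.ext (ext fun j =>
    eq_of_specProj_eq (isSelfAdjoint_apply x.2 j) (isSelfAdjoint_apply y.2 j)
      fun t => (projEquiv (m j)).injective (h j t))
  mono x j s t h := (projEquiv (m j)).monotone (specProj_mono _ h)
  right x j t := by
    obtain ⟨s, hs, h⟩ := exists_specProj_eq ((x : MatSum m) j) t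
    exact ⟨s, hs, congrArg _ h⟩
  bounded x := by
    obtain ⟨C, -, hC⟩ := norm_apply_le (x : MatSum m)
    exact ⟨C, fun j =>
      ⟨fun t ht => projEquiv_of_val_eq_zero (specProj_of_lt (by linarith [hC j])),
        fun t ht => projEquiv_of_val_eq_one
          (specProj_of_ge (isSelfAdjoint_apply x.2 j) ((hC j).trans ht))⟩⟩
  exists_step a b hab p := by
    obtain ⟨α, hα⟩ := a.2
    obtain ⟨β, hβ⟩ := b.2
    have hP : ∀ j, IsStarProjection ((p j).starProjection : MatAlg (m j)) := fun j =>
      isStarProjection_starProjection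
    have hr : ∀ r : ℝ, IsSelfAdjoint (r : ℂ) := Complex.conj_ofReal
    refine ⟨⟨ofBounded (fun j => (a.1 j : ℂ) • (p j).starProjection +
      (b.1 j : ℂ) • (1 - (p j).starProjection)) (α + β) fun j => ?_, ?_⟩, fun j t => ?_⟩
    · refine (norm_add_le _ _).trans (add_le_add ?_ ?_)
      · rw [norm_smul, Complex.norm_real]
        exact (mul_le_of_le_one_right (norm_nonneg _) (hP j).norm_le).trans (hα j)
      · rw [norm_smul, Complex.norm_real]
        exact (mul_le_of_le_one_right (norm_nonneg _) (hP j).one_sub.norm_le).trans (hβ j)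
    · exact ext fun j => ((hr _).smul (hP j).isSelfAdjoint).add
        ((hr _).smul (hP j).one_sub.isSelfAdjoint)
    · exact projEquiv_specProj_step (hab j) (p j) t

theorem spectralModel_le_iff (x y : selfAdjoint (MatSum m)) :
    (spectralModel m).le x y ↔ SpectralLE x y := by
  rw [spectralLE_iff]
  exact forall_congr' fun j => forall_congr' fun t => (projEquiv (m j)).le_iff_le

end MatSum

/-! ### Spectral order isomorphisms -/

/-- Spectral order isomorphisms in terms of the spectral projections of the components. -/
theorem IsSpectralOrderIso.exists_specProj_eq {Λ Γ : Type*} {m : Λ → ℕ} {n : Γ → ℕ}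
    [∀ j, NeZero (m j)] [∀ k, NeZero (n k)]
    {Φ : selfAdjoint (MatSum m) → selfAdjoint (MatSum n)} (hΦ : IsSpectralOrderIso Φ) :
    ∃ (σ : Λ ≃ Γ) (f : Λ → ℝ ≃o ℝ) (T : ∀ j, Proj (MatAlg (m j)) ≃o Proj (MatAlg (n (σ j)))),
      ∀ x j t, specProj ((Φ x : MatSum n) (σ j)) (f j t) =
        T j (specProj ((x : MatSum m) j) t) := by
  obtain ⟨σ, f, T, h⟩ := SpectralModel.exists_forall_E_map
    (M := MatSum.spectralModel m) (M' := MatSum.spectralModel n)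
    (fun j p => Submodule.exists_two_isCompl p) (fun k p => Submodule.exists_two_isCompl p)
    (Equiv.ofBijective Φ hΦ.bijective) fun x y => by
      rw [MatSum.spectralModel_le_iff, MatSum.spectralModel_le_iff]
      exact hΦ.le_iff x y
  refine ⟨σ, f, fun j => ((projEquiv (m j)).trans (T j)).trans (projEquiv (n (σ j))).symm,
    fun x j t => ?_⟩
  exact (OrderIso.eq_symm_apply _).2 (h x j t)

/-- The identification of the projection lattices that goes with `matCast`. -/
def projCast {a b : ℕ} (h : a = b) : Proj (MatAlg a) ≃o Proj (MatAlg b) :=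
  h ▸ OrderIso.refl _

/-- The lattice isomorphism is composed with the identification of the two matrix algebras in order
to be an automorphism. -/
theorem exists_isTheta_matCast {a b : ℕ} (h : a = b) (T : Proj (MatAlg a) ≃o Proj (MatAlg b))
    (f : ℝ ≃o ℝ) {x : MatAlg a} {z : MatAlg b} (hx : IsSelfAdjoint x) (hz : IsSelfAdjoint z)
    (hT : ∀ t, specProj z (f t) = T (specProj x t)) :
    ∃ y, IsTheta (T.trans (projCast h.symm)) (cfc f x) y ∧ z = matCast h y := by
  subst h
  refine ⟨z, ⟨_, isSpectralFamilyOf_specProj (cfc_predicate _ _), ?_⟩, rfl⟩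
  convert isSpectralFamilyOf_specProj hz using 1
  funext t
  obtain ⟨s, rfl⟩ := f.surjective t
  rw [hT, specProj_cfc hx]
  rfl

theorem corollary5p3 {Λ Γ : Type*} (m : Λ → ℕ) (n : Γ → ℕ)
    [∀ j, NeZero (m j)] [∀ k, NeZero (n k)]
    (Φ : selfAdjoint (MatSum m) → selfAdjoint (MatSum n)) (hΦ : IsSpectralOrderIso Φ) :
    ∃ (π : Γ ≃ Λ) (hπ : ∀ j : Λ, m j = n (π.symm j))
      (f : Λ → ℝ → ℝ) (τ : ∀ j : Λ, Proj (MatAlg (m j)) ≃o Proj (MatAlg (m j))),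
      (∀ j, StrictMono (f j) ∧ Function.Bijective (f j)) ∧
      ∀ (x : selfAdjoint (MatSum m)) (k : Γ),
        ∃ y : MatAlg (m (π k)),
          IsTheta (τ (π k)) (cfc (f (π k)) ((x : MatSum m) (π k))) y ∧
          (Φ x : MatSum n) k =
            matCast ((hπ (π k)).trans (congrArg n (π.symm_apply_apply k))) y := by
  obtain ⟨σ, f, T, h⟩ := hΦ.exists_specProj_eq
  have hm : ∀ j, m j = n (σ j) := fun j =>
    eq_of_submodule_orderIso (((projEquiv (m j)).symm.trans (T j)).trans (projEquiv (n (σ j))))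
  refine ⟨σ.symm, hm, fun j => f j, fun j => (T j).trans (projCast (hm j).symm),
    fun j => ⟨(f j).strictMono, (f j).bijective⟩, fun x k => ?_⟩
  -- Decoupling `j` from `k` lets the equation `σ j = k` be eliminated.
  have key : ∀ j k (_ : σ j = k) (e : m j = n k), ∃ y : MatAlg (m j),
      IsTheta ((T j).trans (projCast (hm j).symm)) (cfc (f j) ((x : MatSum m) j)) y ∧
        (Φ x : MatSum n) k = matCast e y := by
    rintro j _ rfl e
    exact exists_isTheta_matCast e (T j) (f j) (MatSum.isSelfAdjoint_apply x.2 j)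
      (MatSum.isSelfAdjoint_apply (Φ x).2 _) (h x j)
  exact key _ k (σ.apply_symm_apply k) _

end
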